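/- Let $0<\alpha<2$, $0<H<1$, $\rho\ge 0$. On a probability space let the following be given. * $(\Gamma_n)_{n\ge1}$ are the arrival times of a Poisson process of rate $1$ on $[0,\infty)$, and $(G_n)_{n\ge1}$, $(X'_n)_{n\ge1}$ are sequences of standard normal random variables. * $(X_n)_{n\ge1}$ are random variables with common density $\varphi$ with respect to Lebesgue measure on $\mathbb R$, where $\varphi$ is (a.e.) positive and, for some $q>0$, $\int_{\mathbb R}\varphi(x)^{1-q/\alpha}e^{-ax^2}\,dx<\infty$ for all $a>0$. * $(f_n)_{n\ge1}$ are identically distributed non-negative continuous random functions $f_n:\mathbb R\times[0,\infty)\to\mathbb R$ such that, for every compact $K\subset[0,\infty)$ and every $p>0$, $\sup_{x\in\mathbb R}\mathbb E\big[\sup_{t\in K}|f_n(x,t)|^p\big]<\infty$; and $(B^{H,n})_{n\ge1}$ are fractional Brownian motions with Hurst parameter $H$ such that, almost surely, for all $t\ge0$ the support of $f_n(\cdot,t)$ is contained in $\big[\inf_{s\le t}B^{H,n}_s-\rho,\ \sup_{s\le t}B^{H,n}_s+\rho\big]$. * The sequence $(\Gamma_n)_n$, the variables $G_1,G_2,\dots$,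 the variables $X'_1,X'_2,\dots$ and the pairs $(f_1,B^{H,1}),(f_2,B^{H,2}),\dots$ are mutually independent, and the same holds with $X_1,X_2,\dots$ in place of $X'_1,X'_2,\dots$. Then for every $t\ge0$ the series $$Y(t)=\sum_{n\ge1}\Gamma_n^{-1/\alpha}G_n\,e^{X_n'^2/(2\alpha)}f_n(X'_n,t),\qquad Y_\varphi(t)=\sum_{n\ge1}\Gamma_n^{-1/\alpha}G_n\,\varphi(X_n)^{-1/\alpha}f_n(X_n,t)$$ converge almost surely, and the processes $(Y_\varphi(t))_{t\ge0}$ and $\big((2\pi)^{1/(2\alpha)}\,Y(t)\big)_{t\ge0}$ have the same distribution, i.e. the same law on $\mathbb R^{[0,\infty)}$ with the product $\sigma$-algebra (equivalently, the same finite-dimensional distributions). -/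

import Mathlib

open MeasureTheory ProbabilityTheory Filter Topology
open scoped NNReal ENNReal

namespace ShotNoise

/-- `B` is a fractional Brownian motion of Hurst parameter `H`: a centred Gaussian process on
`[0, ∞)` with covariance `(s^{2H} + t^{2H} - |t - s|^{2H}) / 2` and a.s. continuous paths. -/
structure IsFractionalBrownianMotion {Ω : Type*} [MeasurableSpace Ω] (P : Measure Ω)
    (H : ℝ) (B : ℝ≥0 → Ω → ℝ) : Prop where
  measurable : ∀ t, Measurable (B t)
  isGaussianProcess : IsGaussianProcess B P
  mean_zero : ∀ t, ∫ ω, B t ω ∂P = 0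
  covariance_eq : ∀ s t : ℝ≥0, covariance (B s) (B t) P =
    ((s : ℝ) ^ (2 * H) + (t : ℝ) ^ (2 * H) - |(t : ℝ) - (s : ℝ)| ^ (2 * H)) / 2
  continuous_paths : ∀ᵐ ω ∂P, Continuous (fun t => B t ω)

/-- The interarrival times `Γ₁, Γ₂ - Γ₁, Γ₃ - Γ₂, …`; here `Γ n` is the arrival time number
`n + 1`. -/
def interarrival {Ω : Type*} (Γ : ℕ → Ω → ℝ) : ℕ → Ω → ℝ
  | 0 => Γ 0
  | n + 1 => fun ω => Γ (n + 1) ω - Γ n ω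

/-- `Γ 0 < Γ 1 < …` are the arrival times of a Poisson process of rate `1` on `[0, ∞)`:
the interarrival times are independent and exponentially distributed with parameter `1`. -/
structure IsPoissonArrivalTimes {Ω : Type*} [MeasurableSpace Ω] (P : Measure Ω)
    (Γ : ℕ → Ω → ℝ) : Prop where
  measurable : ∀ n, Measurable (Γ n)
  indep : iIndepFun (interarrival Γ) P
  law : ∀ n, HasLaw (interarrival Γ n) (expMeasure 1) P

/-- The uniform norm over `K` of a function on `[0, ∞)`, in `[0, ∞]`. -/
noncomputable def uniformNormOn (K : Set ℝ≥0) (g : ℝ≥0 → ℝ) : ℝ≥0∞ := ⨆ t ∈ K, ‖g t‖ₑ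

/-- The assumptions on the random functions `f n : ℝ × [0, ∞) → ℝ` and the fractional Brownian
motions `B n` that control their supports (all but the independence, which is part of
`MutuallyIndependent`). -/
structure IsKernelSequence {Ω : Type*} [MeasurableSpace Ω] (P : Measure Ω) (H ρ : ℝ)
    (f : ℕ → Ω → ℝ × ℝ≥0 → ℝ) (B : ℕ → ℝ≥0 → Ω → ℝ) : Prop where
  /-- each `f n` is a random function ... -/
  measurable : ∀ n, Measurable (f n)
  /-- ... which is continuous ... -/
  continuous : ∀ n ω, Continuous (f n ω)
  /-- ... and non-negative -/
  nonneg : ∀ n ω z, 0 ≤ f n ω z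
  /-- the `f n` are copies of one random function -/
  identDistrib : ∀ m n, IdentDistrib (f m) (f n) P P
  /-- `E ‖f n (x, ·)‖_K ^ p` is bounded uniformly in `x` -/
  moment_bound : ∀ n, ∀ K : Set ℝ≥0, IsCompact K → ∀ p : ℝ, 0 < p → ∃ C : ℝ≥0, ∀ x : ℝ,
    ∫⁻ ω, uniformNormOn K (fun t => f n ω (x, t)) ^ p ∂P ≤ C
  isFBM : ∀ n, IsFractionalBrownianMotion P H (B n)
  /-- the support of `f n (·, t)` lies in `[inf_{s ≤ t} B_s - ρ, sup_{s ≤ t} B_s + ρ]` -/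
  support_subset : ∀ n, ∀ᵐ ω ∂P, ∀ t : ℝ≥0,
    Function.support (fun x : ℝ => f n ω (x, t)) ⊆
      Set.Icc (sInf ((fun s => B n s ω) '' Set.Iic t) - ρ)
        (sSup ((fun s => B n s ω) '' Set.Iic t) + ρ)

/-- The σ-algebras generated by the sources of randomness: the whole sequence `Γ`, each `G n`,
each `X n`, and each pair `(f n, B n)`. -/
@[reducible] def sources {Ω : Type*} (Γ G X : ℕ → Ω → ℝ) (f : ℕ → Ω → ℝ × ℝ≥0 → ℝ)
    (B : ℕ → ℝ≥0 → Ω → ℝ) : Unit ⊕ ℕ ⊕ ℕ ⊕ ℕ → MeasurableSpace Ω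
  | .inl _ => MeasurableSpace.comap (fun ω n => Γ n ω) inferInstance
  | .inr (.inl n) => MeasurableSpace.comap (G n) inferInstance
  | .inr (.inr (.inl n)) => MeasurableSpace.comap (X n) inferInstance
  | .inr (.inr (.inr n)) =>
      MeasurableSpace.comap (fun ω => (f n ω, fun t => B n t ω)) inferInstance

/-- All the random objects `Γ`, `G 0, G 1, …`, `X 0, X 1, …`, `(f 0, B 0), (f 1, B 1), …` are
mutually independent. -/
def MutuallyIndependent {Ω : Type*} [MeasurableSpace Ω] (P : Measure Ω)
    (Γ G X : ℕ → Ω → ℝ) (f : ℕ → Ω → ℝ × ℝ≥0 → ℝ) (B : ℕ → ℝ≥0 → Ω → ℝ) : Prop :=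
  iIndep (sources Γ G X f B) P

/-- The partial sum of order `N` of the series
`∑ₙ Γₙ^{-1/α} Gₙ w(Xₙ) fₙ(Xₙ, t)` with weight function `w`. -/
noncomputable def partialSum {Ω : Type*} (α : ℝ) (Γ G : ℕ → Ω → ℝ) (w : ℝ → ℝ)
    (X : ℕ → Ω → ℝ) (f : ℕ → Ω → ℝ × ℝ≥0 → ℝ) (N : ℕ) (ω : Ω) (t : ℝ≥0) : ℝ :=
  ∑ n ∈ Finset.range N, Γ n ω ^ (-1 / α) * G n ω * w (X n ω) * f n ω (X n ω, t)

/-- The sum of the series, as a process indexed by `t ≥ 0`: the pointwise limit of the partial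
sums (an arbitrary constant where they diverge). -/
noncomputable def series {Ω : Type*} (α : ℝ) (Γ G : ℕ → Ω → ℝ) (w : ℝ → ℝ)
    (X : ℕ → Ω → ℝ) (f : ℕ → Ω → ℝ × ℝ≥0 → ℝ) (ω : Ω) (t : ℝ≥0) : ℝ :=
  limUnder atTop (fun N => partialSum α Γ G w X f N ω t)

/-- The weight `x ↦ e^{x² / (2α)}` of the series `Y`. -/
noncomputable def gaussWeight (α : ℝ) (x : ℝ) : ℝ := Real.exp (x ^ 2 / (2 * α))

/-- The weight `x ↦ φ(x)^{-1/α}` of the series `Y_φ`. -/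
noncomputable def densityWeight (α : ℝ) (φ : ℝ → ℝ) (x : ℝ) : ℝ := φ x ^ (-1 / α)

end ShotNoise

/-!
# Change of the position law in a stable shot-noise series

The series is a sum of `Γₙ ^ (-1 / α) Gₙ Vₙ` with `Vₙ = w (Xₙ) fₙ (Xₙ, t)`; a linear combination of
its values at finitely many times has the same form, with `Vₙ = w (Xₙ) ∑ θ t * fₙ (Xₙ, t)`. The law
of such a sum is symmetric `α`-stable and depends on the marks `Vₙ` only through `E |V₀| ^ α`
(`IsStableSeriesData.integral_exp_mul_I`). If the positions have density `φ` and `w = φ ^ (-1 / α)`,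
the density cancels in this moment, which becomes the integral of `E |∑ θ t * f₀ (x, t)| ^ α` over
Lebesgue measure (`isStableSeriesData_linComb`). The same holds for normal positions with the weight
`(2π) ^ (1 / (2α)) exp (x ^ 2 / (2α))`, so that both processes have the same characteristic
functions of linear combinations, hence the same law.

The stable law comes from the Laplace functional of the Poisson process,
`E ∏ g (Γₙ) = exp (-∫ (1 - g))` (`tendsto_integral_prod_arrival`). It is proved without point
processes: `K s = exp (-∫_s^∞ (1 - g))` solves the renewal equation
`K s = E [g (s + ξ) K (s + ξ)]` for an exponential variable `ξ`, so that
`E [∏_{k ≤ N} g (Γ k) K (Γ N)]` does not depend on `N`, while `K (Γ N) → 1`. Independent marks are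
integrated out first (`integral_prod_marks`), and the scaling `x = |v| ^ α y` turns
`∫ (1 - E exp (-(x ^ (-1 / α) V) ^ 2 / 2)) dx` into a multiple of `E |V| ^ α`.

Almost sure convergence follows from the same formula. Applied to `exp (-c ^ 2 S / 2)` with
`S = ∑ (Γₙ ^ (-1 / α) Vₙ) ^ 2` it gives `exp (-const * c ^ α)`, and `c → 0` shows that `S < ∞` almost
surely (`IsStableSeriesData.ae_summable_sq`). Given `Γ` and `V`, the series is then a square-summable
Gaussian series, which converges by the martingale convergence theorem.

It remains to bound `∫ E |∑ θ t * f (x, t)| ^ α dx`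
(`IsKernelSequence.lintegral_lintegral_linComb_ne_top`). Where the integrand does not vanish, `|x|`
is at most `M + ρ` with `M` the running maximum of the fractional Brownian motion, whose fourth
moment is finite by Fernique's theorem (`exists_bound_of_isGaussianProcess`); this gives the decay
`(1 + |x|) ^ (-2)`.
-/

namespace ShotNoise

/-! ### Integrals of functions of independent variables -/

section Independence

variable {Ω : Type*} {β γ : Type*} [MeasurableSpace β] [MeasurableSpace γ]

theorem integral_comp_prodMk_of_indepFun [MeasurableSpace Ω] {P : Measure Ω} [IsFiniteMeasure P]
    {E : Type*} [NormedAddCommGroup E] [NormedSpace ℝ E]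
    {Z : Ω → γ} {X : Ω → β} (hZ : Measurable Z) (hX : Measurable X) (hZX : IndepFun Z X P)
    {F : γ × β → E} (hF : StronglyMeasurable F) (hFint : Integrable (fun ω => F (Z ω, X ω)) P) :
    ∫ ω, F (Z ω, X ω) ∂P = ∫ ω, ∫ x, F (Z ω, x) ∂(P.map X) ∂P := by
  have h := hZX.map_prod_eq_prod_map_map hZ.aemeasurable hX.aemeasurable
  have hF' : Integrable F ((P.map Z).prod (P.map X)) := by
    rw [← h]
    exact (integrable_map_measure hF.aestronglyMeasurable (hZ.prodMk hX).aemeasurable).2 hFint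
  rw [← integral_map (φ := fun ω => (Z ω, X ω)) (hZ.prodMk hX).aemeasurable
    hF.aestronglyMeasurable, h, integral_prod _ hF',
    integral_map hZ.aemeasurable hF'.integral_prod_left.aestronglyMeasurable]

theorem lintegral_comp_prodMk_of_indepFun [MeasurableSpace Ω] {P : Measure Ω} [IsFiniteMeasure P]
    {Z : Ω → γ} {X : Ω → β} (hZ : Measurable Z) (hX : Measurable X) (hZX : IndepFun Z X P)
    {F : γ × β → ℝ≥0∞} (hF : Measurable F) :
    ∫⁻ ω, F (Z ω, X ω) ∂P = ∫⁻ x, ∫⁻ ω, F (Z ω, x) ∂P ∂(P.map X) := by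
  have h := hZX.map_prod_eq_prod_map_map hZ.aemeasurable hX.aemeasurable
  rw [← lintegral_map (f := F) hF (hZ.prodMk hX), h, lintegral_prod_symm _ hF.aemeasurable]
  refine lintegral_congr fun x => ?_
  rw [lintegral_map (by fun_prop) hZ]

end Independence

/-! ### The Laplace functional of the arrival times of a Poisson process -/

theorem integral_expMeasure_one {E : Type*} [NormedAddCommGroup E] [NormedSpace ℝ E] (F : ℝ → E) :
    ∫ u, F u ∂(expMeasure 1) = ∫ u in Set.Ioi (0 : ℝ), Real.exp (-u) • F u := by
  have h : (expMeasure 1) = volume.withDensity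
      (fun x => ENNReal.ofReal (exponentialPDFReal 1 x)) := rfl
  rw [h, integral_withDensity_eq_integral_toReal_smul
    (by exact (measurable_exponentialPDFReal 1).ennreal_ofReal)
    (by simp), ← integral_Ici_eq_integral_Ioi, ← integral_indicator measurableSet_Ici]
  refine integral_congr_ae (ae_of_all _ fun u => ?_)
  simp only [Set.indicator_apply, Set.mem_Ici]
  have := exponentialPDF_eq 1 u
  rw [exponentialPDF] at this
  rw [this]
  split_ifs with hu
  · simp [Real.exp_nonneg]
  · simp

theorem ae_pos_expMeasure_one : ∀ᵐ u ∂(expMeasure 1), 0 < u := by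
  have h : (expMeasure 1) = volume.withDensity (exponentialPDF 1) := rfl
  rw [h, ae_withDensity_iff (by exact (measurable_exponentialPDFReal 1).ennreal_ofReal)]
  filter_upwards [(measure_eq_zero_iff_ae_notMem.1 (measure_singleton (μ := volume) (0:ℝ)))]
    with u hu0 hu
  by_contra hlt
  exact hu (exponentialPDF_of_neg (lt_of_le_of_ne (not_lt.1 hlt) hu0))

section Tail

variable {h : ℝ → ℝ}

/-- The exponential of minus the mass of `h` on `(s, ∞)`: the Laplace functional of a Poisson
process on `(s, ∞)`, evaluated at the multiplicative functional with factor `1 - h`. -/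
noncomputable def tailExp (h : ℝ → ℝ) (s : ℝ) : ℝ := Real.exp (-∫ v in Set.Ioi s, h v)

theorem tailExp_pos (s : ℝ) : 0 < tailExp h s := Real.exp_pos _

theorem tailExp_le_one (h0 : ∀ x, 0 ≤ h x) (s : ℝ) : tailExp h s ≤ 1 :=
  Real.exp_le_one_iff.2 (neg_nonpos.2 (integral_nonneg h0))

theorem tailExp_eq (hint : Integrable h) (s : ℝ) :
    tailExp h s = Real.exp (-((∫ v in Set.Ioi 0, h v) - ∫ v in (0 : ℝ)..s, h v)) := by
  rw [tailExp, ← intervalIntegral.integral_interval_add_Ioi (a := 0) (b := s) hint.integrableOn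
    hint.integrableOn]
  congr 2
  ring

theorem continuous_tailExp (hint : Integrable h) : Continuous (tailExp h) := by
  rw [funext (tailExp_eq hint)]
  have := intervalIntegral.continuous_primitive (f := h)
    (fun a b => hint.intervalIntegrable) 0
  fun_prop

theorem hasDerivAt_tailExp (hint : Integrable h) {s : ℝ} (hs : ContinuousAt h s) :
    HasDerivAt (tailExp h) (h s * tailExp h s) s := by
  have h1 := intervalIntegral.integral_hasDerivAt_right (a := 0) (hint.intervalIntegrable)
    (hint.aestronglyMeasurable.stronglyMeasurableAtFilter) hs
  have h2 := (h1.const_sub (∫ v in Set.Ioi 0, h v)).fun_neg.exp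
  rw [← funext (tailExp_eq hint)] at h2
  convert! h2 using 1
  rw [tailExp_eq hint]
  ring

theorem tendsto_tailExp {ι : Type*} {l : Filter ι} [l.IsCountablyGenerated] {b : ι → ℝ}
    (hb : Tendsto b l atTop) : Tendsto (fun i => tailExp h (b i)) l (𝓝 1) := by
  have := (tendsto_integral_Ioi_zero (μ := volume) (f := h) hb).neg.rexp
  simpa [tailExp] using this

/-- The renewal equation: `tailExp h s` is obtained by conditioning on the first arrival after
`s`. -/
theorem integral_expMeasure_mul_tailExp (h1 : ∀ x, h x ≤ 1)
    (hint : Integrable h)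
    (hcont : ContinuousOn h (Set.Ioi 0)) {s : ℝ} (hs : 0 ≤ s) :
    ∫ u, (1 - h (s + u)) * tailExp h (s + u) ∂(expMeasure 1) = tailExp h s := by
  rw [integral_expMeasure_one]
  have key := integral_Ioi_of_hasDerivAt_of_nonneg
    (g := fun u => -(Real.exp (-u) * tailExp h (s + u)))
    (g' := fun u => Real.exp (-u) • ((1 - h (s + u)) * tailExp h (s + u))) (a := 0) (l := 0)
    ?_ ?_ ?_ ?_
  · rw [key]; simp
  · have := continuous_tailExp hint
    exact Continuous.continuousWithinAt (by fun_prop)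
  · intro x hx
    have hx' : 0 < x := hx
    have hd := hasDerivAt_tailExp hint (s := s + x)
      ((hcont _ (by simp only [Set.mem_Ioi]; linarith)).continuousAt (Ioi_mem_nhds (by linarith)))
    have hd2 := HasDerivAt.comp_const_add s x hd
    have hd3 := ((hasDerivAt_neg x).exp.mul hd2).neg
    convert! hd3 using 1
    simp only [smul_eq_mul]
    ring
  · intro x _
    exact smul_nonneg (Real.exp_nonneg _)
      (mul_nonneg (sub_nonneg.2 (h1 _)) (tailExp_pos _).le)
  · have e1 : Tendsto (fun u : ℝ => s + u) atTop atTop := tendsto_atTop_add_const_left _ _ tendsto_id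
    have := (Real.tendsto_exp_neg_atTop_nhds_zero.mul (tendsto_tailExp (h := h) e1)).neg
    simpa using this

end Tail

theorem arrival_eq_sum {Ω : Type*} (Γ : ℕ → Ω → ℝ) (n : ℕ) (ω : Ω) :
    Γ n ω = ∑ i ∈ Finset.range (n + 1), interarrival Γ i ω := by
  induction n with
  | zero => simp [interarrival]
  | succ n ih => rw [Finset.sum_range_succ, ← ih, interarrival]; ring

section Arrival

variable {Ω : Type*} [MeasurableSpace Ω] {P : Measure Ω} {Γ : ℕ → Ω → ℝ}

theorem measurable_interarrival (hΓ : ∀ n, Measurable (Γ n)) (n : ℕ) :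
    Measurable (interarrival Γ n) := by
  cases n with
  | zero => exact hΓ 0
  | succ n => exact (hΓ (n + 1)).sub (hΓ n)

theorem ae_arrival_pos (hΓ : IsPoissonArrivalTimes P Γ) : ∀ᵐ ω ∂P, ∀ n, 0 < Γ n ω := by
  have h : ∀ᵐ ω ∂P, ∀ n, 0 < interarrival Γ n ω := by
    rw [ae_all_iff]
    intro n
    refine ae_of_ae_map (measurable_interarrival hΓ.measurable n).aemeasurable ?_
    rw [(hΓ.law n).map_eq]
    exact ae_pos_expMeasure_one
  filter_upwards [h] with ω hω n
  rw [arrival_eq_sum Γ]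
  exact Finset.sum_pos (fun i _ => hω i) (by simp)

/-- The next interarrival time is independent of any variable determined by the past arrivals. -/
theorem indepFun_interarrival_succ (hΓ : IsPoissonArrivalTimes P Γ) {γ : Type*}
    [MeasurableSpace γ] (n : ℕ) {F : (Fin (n + 1) → ℝ) → γ} (hF : Measurable F) :
    IndepFun (fun ω => F (fun k => Γ k ω)) (interarrival Γ (n + 1)) P := by
  have hm : ∀ i, StronglyMeasurable (interarrival Γ i) := fun i =>
    (measurable_interarrival hΓ.measurable i).stronglyMeasurable
  have h := (hΓ.indep.indep_comap_natural_of_lt hm (Nat.lt_succ_self n)).symm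
  rw [IndepFun_iff_Indep]
  refine indep_of_indep_of_le_left h ?_
  have hk : ∀ k : Fin (n + 1), Measurable[Filtration.natural (interarrival Γ) hm n] (Γ k) := by
    intro k
    rw [funext (arrival_eq_sum Γ k)]
    refine Finset.measurable_fun_sum _ fun i hi => ?_
    refine ((Filtration.stronglyAdapted_natural hm i).measurable).mono
      (Filtration.mono _ ?_) le_rfl
    have := k.2
    simp at hi
    omega
  have : Measurable[Filtration.natural (interarrival Γ) hm n] (fun ω => F (fun k => Γ k ω)) :=
    hF.comp (@measurable_pi_lambda _ _ _ (Filtration.natural (interarrival Γ) hm n) _ _ hk)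
  exact this.comap_le

theorem tendsto_arrival_atTop [IsProbabilityMeasure P] (hΓ : IsPoissonArrivalTimes P Γ) :
    ∀ᵐ ω ∂P, Tendsto (fun n => Γ n ω) atTop atTop := by
  have hm := measurable_interarrival hΓ.measurable
  have hmΓ := hΓ.measurable
  -- `E exp (-Γ n)` decays geometrically, so that `∑ exp (-Γ n)` converges almost surely
  set c : ℝ≥0∞ := ∫⁻ u, ENNReal.ofReal (Real.exp (-u)) ∂(expMeasure 1) with hc
  have hc1 : c < 1 := by
    have hp : IsProbabilityMeasure (expMeasure 1) := isProbabilityMeasure_expMeasure one_pos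
    calc c < ∫⁻ u, 1 ∂(expMeasure 1) := by
          refine lintegral_strict_mono (IsProbabilityMeasure.ne_zero _) (by fun_prop) ?_ ?_
          · have : c ≤ ∫⁻ u, 1 ∂(expMeasure 1) := by
              refine lintegral_mono_ae ?_
              filter_upwards [ae_pos_expMeasure_one] with u hu
              rw [ENNReal.ofReal_le_one]
              exact Real.exp_le_one_iff.2 (by linarith)
            exact (this.trans_lt (by simp)).ne
          · filter_upwards [ae_pos_expMeasure_one] with u hu
            rw [ENNReal.ofReal_lt_one]
            exact Real.exp_lt_one_iff.2 (by linarith)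
      _ = 1 := by simp
  have hE : ∀ n, ∫⁻ ω, ENNReal.ofReal (Real.exp (-Γ n ω)) ∂P = c ^ (n + 1) := by
    intro n
    induction n with
    | zero =>
      have := (hΓ.law 0).lintegral_comp (f := fun u => ENNReal.ofReal (Real.exp (-u)))
        (by fun_prop)
      simpa [interarrival] using this
    | succ n ih =>
      have hind := indepFun_interarrival_succ hΓ n (F := fun x => x (Fin.last n)) (by fun_prop)
      have h2 := lintegral_comp_prodMk_of_indepFun (by simpa using hmΓ n) (hm (n + 1)) hind
        (F := fun p => ENNReal.ofReal (Real.exp (-p.1)) * ENNReal.ofReal (Real.exp (-p.2)))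
        (by fun_prop)
      have e : ∀ ω, ENNReal.ofReal (Real.exp (-Γ (n + 1) ω)) =
          ENNReal.ofReal (Real.exp (-Γ n ω)) *
            ENNReal.ofReal (Real.exp (-interarrival Γ (n + 1) ω)) := by
        intro ω
        rw [← ENNReal.ofReal_mul (Real.exp_nonneg _), ← Real.exp_add]
        congr 2
        simp only [interarrival]; ring
      simp only [Fin.val_last] at h2
      simp_rw [e, h2]
      rw [(hΓ.law (n + 1)).map_eq]
      have e2 : ∀ x : ℝ, ∫⁻ ω, ENNReal.ofReal (Real.exp (-Γ n ω)) *
          ENNReal.ofReal (Real.exp (-x)) ∂P = c ^ (n + 1) * ENNReal.ofReal (Real.exp (-x)) := by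
        intro x
        rw [lintegral_mul_const _ (by fun_prop), ih]
      simp_rw [e2]
      rw [lintegral_const_mul _ (by fun_prop), ← hc, pow_succ c (n + 1)]
  have hsum : ∫⁻ ω, ∑' n, ENNReal.ofReal (Real.exp (-Γ n ω)) ∂P < ∞ := by
    rw [lintegral_tsum (fun n => by fun_prop)]
    simp_rw [hE, pow_succ]
    rw [ENNReal.tsum_mul_right, ENNReal.tsum_geometric]
    refine ENNReal.mul_lt_top ?_ (hc1.trans (by simp))
    rw [ENNReal.inv_lt_top]
    exact tsub_pos_of_lt hc1
  filter_upwards [ae_lt_top (Measurable.tsum fun n => by fun_prop) hsum.ne] with ω hω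
  have h1 := ENNReal.tendsto_atTop_zero_of_tsum_ne_top hω.ne
  have h2 : Tendsto (fun n => Real.exp (-Γ n ω)) atTop (𝓝 0) := by
    have := (ENNReal.tendsto_toReal (by simp)).comp h1
    simpa [Function.comp_def, Real.exp_nonneg] using this
  have h3 := Real.tendsto_exp_comp_nhds_zero.1 h2
  simpa using tendsto_neg_atBot_iff.1 h3

/-- **Laplace functional of the Poisson process**, in terms of its arrival times. -/
theorem tendsto_integral_prod_arrival [IsProbabilityMeasure P] (hΓ : IsPoissonArrivalTimes P Γ)
    {g : ℝ → ℝ} (hcont : ContinuousOn g (Set.Ioi 0)) (hg0 : ∀ x, 0 < x → 0 ≤ g x)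
    (hg1 : ∀ x, 0 < x → g x ≤ 1) (hint : IntegrableOn (fun x => 1 - g x) (Set.Ioi 0)) :
    Tendsto (fun N => ∫ ω, ∏ k ∈ Finset.range N, g (Γ k ω) ∂P) atTop
      (𝓝 (Real.exp (-∫ x in Set.Ioi 0, (1 - g x)))) := by
  set h : ℝ → ℝ := (Set.Ioi 0).indicator (fun x => 1 - g x) with hh
  have hmΓ := hΓ.measurable
  have h0 : ∀ x, 0 ≤ h x := fun x =>
    Set.indicator_nonneg (fun y hy => sub_nonneg.2 (hg1 y hy)) x
  have h1 : ∀ x, h x ≤ 1 := fun x =>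
    Set.indicator_le' (fun y hy => by linarith [hg0 y hy]) (fun _ _ => zero_le_one) x
  have hhint : Integrable h := hint.integrable_indicator measurableSet_Ioi
  have hhcont : ContinuousOn h (Set.Ioi 0) :=
    (continuousOn_const.sub hcont).congr (Set.eqOn_indicator)
  have hmeas : Measurable h := by
    have : ContinuousOn h ((Set.Ioi 0)) := hhcont
    have h2 := this.measurable_piecewise (g := fun _ => (0:ℝ)) (s := Set.Ioi 0)
      continuousOn_const measurableSet_Ioi
    convert! h2 using 1
    ext x
    by_cases hx : x ∈ Set.Ioi (0:ℝ)
    · simp [Set.piecewise, hx]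
    · simp [Set.piecewise, hx, hh]
  have hgh : ∀ x, 0 < x → 1 - h x = g x := by
    intro x hx
    simp [hh, hx]
  have hI : ∫ x in Set.Ioi 0, (1 - g x) = ∫ x in Set.Ioi 0, h x :=
    setIntegral_congr_fun measurableSet_Ioi (fun x hx => by simp [hh, Set.mem_Ioi.1 hx])
  have hK : Measurable (tailExp h) := (continuous_tailExp hhint).measurable
  have hprod0 : ∀ N (x : ℕ → ℝ), 0 ≤ ∏ k ∈ Finset.range N, (1 - h (x k)) := fun N x =>
    Finset.prod_nonneg fun k _ => sub_nonneg.2 (h1 _)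
  have hprod1 : ∀ N (x : ℕ → ℝ), ∏ k ∈ Finset.range N, (1 - h (x k)) ≤ 1 := fun N x =>
    Finset.prod_le_one (fun k _ => sub_nonneg.2 (h1 _)) (fun k _ => by linarith [h0 (x k)])
  -- the compensated products have constant expectation
  have hstep : ∀ N, ∫ ω, (∏ k ∈ Finset.range (N + 1), (1 - h (Γ k ω))) * tailExp h (Γ N ω) ∂P
      = tailExp h 0 := by
    intro N
    induction N with
    | zero =>
      have e := (hΓ.law 0).integral_comp (f := fun u => (1 - h (0 + u)) * tailExp h (0 + u))
        (by fun_prop)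
      rw [integral_expMeasure_mul_tailExp h1 hhint hhcont le_rfl] at e
      simpa [interarrival, Function.comp_def] using e
    | succ N ih =>
      have hind := indepFun_interarrival_succ hΓ N (γ := ℝ × ℝ)
        (F := fun x => (∏ k, (1 - h (x k)), x (Fin.last N))) (by fun_prop)
      have e1 : ∀ ω, ∏ k : Fin (N + 1), (1 - h (Γ k ω)) =
          ∏ k ∈ Finset.range (N + 1), (1 - h (Γ k ω)) := fun ω =>
        Fin.prod_univ_eq_prod_range (fun k => 1 - h (Γ k ω)) (N + 1)
      have e2 := integral_comp_prodMk_of_indepFun (P := P) (by fun_prop)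
        (measurable_interarrival hmΓ (N + 1)) hind
        (F := fun p : (ℝ × ℝ) × ℝ => p.1.1 * ((1 - h (p.1.2 + p.2)) * tailExp h (p.1.2 + p.2)))
        (by
          refine Measurable.stronglyMeasurable ?_
          fun_prop) ?_
      · have e3 : ∀ ω, Γ N ω + interarrival Γ (N + 1) ω = Γ (N + 1) ω := fun ω => by
          simp [interarrival]
        simp only [e1, Fin.val_last, e3] at e2
        rw [← ih]
        simp_rw [Finset.prod_range_succ _ (N + 1), mul_assoc]
        rw [e2]
        refine integral_congr_ae ?_
        filter_upwards [ae_arrival_pos hΓ] with ω hω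
        rw [integral_const_mul, (hΓ.law (N + 1)).map_eq,
          integral_expMeasure_mul_tailExp h1 hhint hhcont (hω N).le]
      · refine Integrable.of_bound (C := 1) (Measurable.aestronglyMeasurable ?_)
          (ae_of_all _ fun ω => ?_)
        · have := measurable_interarrival hmΓ (N + 1)
          fun_prop
        · have a1 := hprod0 (N + 1) (fun k => Γ k ω)
          have a2 := hprod1 (N + 1) (fun k => Γ k ω)
          simp only [e1, Fin.val_last]
          rw [norm_mul, norm_mul, Real.norm_of_nonneg a1, Real.norm_of_nonneg (sub_nonneg.2 (h1 _)),
            Real.norm_of_nonneg (tailExp_pos _).le]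
          refine mul_le_one₀ a2 (mul_nonneg (sub_nonneg.2 (h1 _)) (tailExp_pos _).le) ?_
          exact mul_le_one₀ (sub_le_self _ (h0 _)) (tailExp_pos _).le (tailExp_le_one h0 _)
  rw [hI]
  change Tendsto _ _ (𝓝 (tailExp h 0))
  rw [← tendsto_add_atTop_iff_nat 1]
  have hdiff : Tendsto (fun N => ∫ ω, (∏ k ∈ Finset.range (N + 1), (1 - h (Γ k ω))) *
      (1 - tailExp h (Γ N ω)) ∂P) atTop (𝓝 (∫ ω, (0 : ℝ) ∂P)) := by
    refine tendsto_integral_of_dominated_convergence (fun _ => 1) (fun N => ?_)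
      (integrable_const _) (fun N => ae_of_all _ fun ω => ?_) ?_
    · exact Measurable.aestronglyMeasurable (by fun_prop)
    · rw [norm_mul, Real.norm_of_nonneg (hprod0 _ (fun k => Γ k ω)),
        Real.norm_of_nonneg (sub_nonneg.2 (tailExp_le_one h0 _))]
      exact mul_le_one₀ (hprod1 _ (fun k => Γ k ω)) (sub_nonneg.2 (tailExp_le_one h0 _))
        (sub_le_self _ (tailExp_pos _).le)
    · filter_upwards [tendsto_arrival_atTop hΓ] with ω hω
      have hz : Tendsto (fun N => 1 - tailExp h (Γ N ω)) atTop (𝓝 0) := by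
        simpa using (tendsto_tailExp (h := h) hω).const_sub 1
      refine squeeze_zero_norm (fun N => ?_) hz
      rw [norm_mul, Real.norm_of_nonneg (hprod0 _ (fun k => Γ k ω)),
        Real.norm_of_nonneg (sub_nonneg.2 (tailExp_le_one h0 _))]
      exact mul_le_of_le_one_left (sub_nonneg.2 (tailExp_le_one h0 _))
        (hprod1 _ (fun k => Γ k ω))
  have hint1 : ∀ N, Integrable (fun ω => ∏ k ∈ Finset.range (N + 1), (1 - h (Γ k ω))) P :=
    fun N => Integrable.of_bound (C := 1) (Measurable.aestronglyMeasurable (by fun_prop))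
      (ae_of_all _ fun ω => by
        rw [Real.norm_of_nonneg (hprod0 _ (fun k => Γ k ω))]
        exact hprod1 _ (fun k => Γ k ω))
  have hint2 : ∀ N, Integrable (fun ω => (∏ k ∈ Finset.range (N + 1), (1 - h (Γ k ω))) *
      tailExp h (Γ N ω)) P := fun N =>
    (hint1 N).mul_bdd (c := 1) (Measurable.aestronglyMeasurable (by fun_prop))
      (ae_of_all _ fun ω => by
        rw [Real.norm_of_nonneg (tailExp_pos _).le]
        exact tailExp_le_one h0 _)
  simp_rw [mul_sub, mul_one] at hdiff
  have hd2 := hdiff.add_const (tailExp h 0)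
  simp only [integral_zero, zero_add] at hd2
  refine hd2.congr fun N => ?_
  rw [integral_sub (hint1 N) (hint2 N), hstep, sub_add_cancel]
  refine integral_congr_ae ?_
  filter_upwards [ae_arrival_pos hΓ] with ω hω
  exact Finset.prod_congr rfl fun k _ => hgh _ (hω k)

end Arrival

/-! ### Random series with independent Gaussian coefficients -/

section GaussianSeries

variable {Ω : Type*} [MeasurableSpace Ω] {P : Measure Ω} [IsProbabilityMeasure P]

theorem ae_exists_tendsto_sum_mul_gaussian {G : ℕ → Ω → ℝ} (hGm : ∀ n, Measurable (G n))
    (hG : ∀ n, HasLaw (G n) (gaussianReal 0 1) P) (hGi : iIndepFun G P) {c : ℕ → ℝ}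
    (hc : Summable fun n => c n ^ 2) :
    ∀ᵐ ω ∂P, ∃ y, Tendsto (fun N => ∑ n ∈ Finset.range N, c n * G n ω) atTop (𝓝 y) := by
  have hsm : ∀ n, StronglyMeasurable (G n) := fun n => (hGm n).stronglyMeasurable
  have hmem : ∀ n, MemLp (G n) 2 P := fun n => by
    have h1 : MemLp id 2 (P.map (G n)) := by
      rw [(hG n).map_eq]; exact memLp_id_gaussianReal 2
    exact (memLp_map_measure_iff (by fun_prop) (hGm n).aemeasurable).1 h1
  have hmean : ∀ n, ∫ ω, G n ω ∂P = 0 := fun n => by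
    rw [(hG n).integral_eq]; simp
  have hcmem : ∀ n, MemLp (fun ω => c n * G n ω) 2 P := fun n => (hmem n).const_mul _
  set f : ℕ → Ω → ℝ := fun n ω => ∑ i ∈ Finset.range (n + 1), c i * G i ω with hf
  have hfmem : ∀ n, MemLp (f n) 2 P := fun n => memLp_finsetSum _ fun i _ => hcmem i
  have hfint : ∀ n, Integrable (f n) P := fun n => (hfmem n).integrable (by norm_num)
  have hfmean : ∀ n, ∫ ω, f n ω ∂P = 0 := fun n => by
    rw [integral_finsetSum _ fun i _ => (hcmem i).integrable (by norm_num)]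
    simp [integral_const_mul, hmean]
  have hfm : ∀ n, Measurable (f n) := fun n => by
    have := hGm
    fun_prop
  have hvar : ∀ n, ∫ ω, f n ω ^ 2 ∂P = ∑ i ∈ Finset.range (n + 1), c i ^ 2 := by
    intro n
    rw [← variance_of_integral_eq_zero (hfm n).aemeasurable (hfmean n)]
    have e : f n = ∑ i ∈ Finset.range (n + 1), (fun ω => c i * G i ω) := by
      ext ω; simp [hf]
    rw [e, IndepFun.variance_sum (fun i _ => hcmem i)]
    · refine Finset.sum_congr rfl fun i _ => ?_
      rw [variance_const_mul, (hG i).variance_eq, variance_id_gaussianReal]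
      simp
    · intro i _ j _ hij
      exact (hGi.indepFun hij).comp (measurable_const_mul (c i)) (measurable_const_mul (c j))
  have hmart : Martingale f (Filtration.natural G hsm) P := by
    have hadap : StronglyAdapted (Filtration.natural G hsm) f := fun n => by
      refine Finset.stronglyMeasurable_fun_sum _ fun i hi => ?_
      refine StronglyMeasurable.const_mul ?_ _
      exact ((Filtration.stronglyAdapted_natural hsm i)).mono
        (Filtration.mono _ (by simp at hi; omega))
    refine martingale_nat hadap hfint fun i => ?_
    have e : f (i + 1) = f i + c (i + 1) • G (i + 1) := by
      ext ω
      simp [hf, Finset.sum_range_succ _ (i + 1)]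
    rw [e]
    have h1 := condExp_add (hfint i) ((hmem (i + 1)).integrable (by norm_num) |>.smul (c (i + 1)))
      (Filtration.natural G hsm i)
    have h2 := condExp_smul (μ := P) (c (i + 1)) (G (i + 1)) (Filtration.natural G hsm i)
    have h3 := hGi.condExp_natural_ae_eq_of_lt hsm (Nat.lt_succ_self i)
    have h4 := condExp_of_stronglyMeasurable ((Filtration.natural G hsm).le i) (hadap i) (hfint i)
    filter_upwards [h1, h2, h3] with ω w1 w2 w3
    rw [w1, Pi.add_apply, w2, h4, Pi.smul_apply, w3, hmean]
    simp
  have hbdd : ∀ n, eLpNorm (f n) 1 P ≤ (Real.toNNReal (1 + ∑' i, c i ^ 2) : ℝ≥0) := by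
    intro n
    rw [eLpNorm_one_eq_lintegral_enorm, ← ofReal_integral_norm_eq_lintegral_enorm (hfint n)]
    refine ENNReal.ofReal_le_ofReal ?_
    calc ∫ ω, ‖f n ω‖ ∂P ≤ ∫ ω, (1 + f n ω ^ 2) ∂P := by
          refine integral_mono (hfint n).norm ((integrable_const _).add (hfmem n).integrable_sq)
            fun ω => ?_
          rw [Real.norm_eq_abs]
          nlinarith [sq_abs (f n ω), sq_nonneg (|f n ω| - 1), abs_nonneg (f n ω)]
      _ = 1 + ∑ i ∈ Finset.range (n + 1), c i ^ 2 := by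
          rw [integral_add (integrable_const _) (hfmem n).integrable_sq, hvar]
          simp
      _ ≤ 1 + ∑' i, c i ^ 2 := by
          gcongr
          exact hc.sum_le_tsum _ fun i _ => sq_nonneg _
  filter_upwards [hmart.submartingale.exists_ae_tendsto_of_bdd hbdd] with ω hω
  obtain ⟨y, hy⟩ := hω
  exact ⟨y, (tendsto_add_atTop_iff_nat 1).1 hy⟩

theorem ae_exists_tendsto_sum_mul_gaussian_of_indepFun {G C : ℕ → Ω → ℝ}
    (hGm : ∀ n, Measurable (G n)) (hCm : ∀ n, Measurable (C n))
    (hG : ∀ n, HasLaw (G n) (gaussianReal 0 1) P) (hGi : iIndepFun G P)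
    (hCG : IndepFun (fun ω n => C n ω) (fun ω n => G n ω) P)
    (hC : ∀ᵐ ω ∂P, Summable fun n => C n ω ^ 2) :
    ∀ᵐ ω ∂P, ∃ y, Tendsto (fun N => ∑ n ∈ Finset.range N, C n ω * G n ω) atTop (𝓝 y) := by
  have hGm' : Measurable (fun ω n => G n ω) := measurable_pi_lambda _ hGm
  have hCm' : Measurable (fun ω n => C n ω) := measurable_pi_lambda _ hCm
  have hset : MeasurableSet {p : (ℕ → ℝ) × (ℕ → ℝ) | ∃ y,
      Tendsto (fun N => ∑ n ∈ Finset.range N, p.1 n * p.2 n) atTop (𝓝 y)} :=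
    measurableSet_exists_tendsto fun N => by fun_prop
  have hCG' := hCG.map_prod_eq_prod_map_map hCm'.aemeasurable hGm'.aemeasurable
  refine ae_of_ae_map (f := fun ω => ((fun n => C n ω), fun n => G n ω))
    (p := fun p : (ℕ → ℝ) × (ℕ → ℝ) => ∃ y,
      Tendsto (fun N => ∑ n ∈ Finset.range N, p.1 n * p.2 n) atTop (𝓝 y))
    (hCm'.prodMk hGm').aemeasurable ?_
  have hsummable : MeasurableSet {c : ℕ → ℝ | Summable fun n => c n ^ 2} := by
    simp_rw [summable_iff_not_tendsto_nat_atTop_of_nonneg fun n => sq_nonneg _]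
    exact (measurableSet_tendsto _ fun N => by fun_prop).compl
  rw [hCG', Measure.ae_prod_iff_ae_ae hset]
  filter_upwards [(ae_map_iff hCm'.aemeasurable hsummable).2 hC] with c hc
  exact (ae_map_iff hGm'.aemeasurable (measurableSet_exists_tendsto fun N => by fun_prop)).2
    (ae_exists_tendsto_sum_mul_gaussian hGm hG hGi hc)

end GaussianSeries

/-! ### Poisson points with independent marks -/

section Marks

variable {Ω : Type*} [MeasurableSpace Ω] {P : Measure Ω} [IsProbabilityMeasure P]

/-- Marks that are independent of the points and of one another can be integrated out one at a
time. -/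
theorem integral_prod_marks {𝕜 β : Type*} [RCLike 𝕜] [MeasurableSpace β] {Γ : ℕ → Ω → ℝ}
    {U : ℕ → Ω → β} (hΓ : ∀ n, Measurable (Γ n)) (hU : ∀ n, Measurable (U n))
    (hind : ∀ n, IndepFun (fun ω => ((fun k => Γ k ω), fun k : Fin n => U k ω)) (U n) P)
    {F : ℝ × β → 𝕜} (hF : StronglyMeasurable F) (hF1 : ∀ z, ‖F z‖ ≤ 1) {g : ℝ → 𝕜}
    (hg : ∀ n x, ∫ ω, F (x, U n ω) ∂P = g x) (N : ℕ) {h : (ℕ → ℝ) → 𝕜}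
    (hh : StronglyMeasurable h) (hh1 : ∀ x, ‖h x‖ ≤ 1) :
    ∫ ω, (∏ k ∈ Finset.range N, F (Γ k ω, U k ω)) * h (fun k => Γ k ω) ∂P =
      ∫ ω, (∏ k ∈ Finset.range N, g (Γ k ω)) * h (fun k => Γ k ω) ∂P := by
  have hgm : StronglyMeasurable g := by
    have : g = fun x => ∫ ω, F (x, U 0 ω) ∂P := funext fun x => (hg 0 x).symm
    rw [this]
    exact StronglyMeasurable.integral_prod_right (f := fun x ω => F (x, U 0 ω))
      (hF.comp_measurable (measurable_fst.prodMk ((hU 0).comp measurable_snd)))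
  have hg1 : ∀ x, ‖g x‖ ≤ 1 := fun x => by
    rw [← hg 0 x]
    have := norm_integral_le_of_norm_le_const (μ := P) (C := 1)
      (ae_of_all _ fun ω => hF1 (x, U 0 ω))
    simpa using this
  have hFm := hF.measurable
  induction N generalizing h with
  | zero => simp
  | succ N ih =>
    have hhm := hh.measurable
    have hgm' := hgm.measurable
    have e1 : ∀ ω, ∏ k : Fin N, F (Γ k ω, U k ω) = ∏ k ∈ Finset.range N, F (Γ k ω, U k ω) :=
      fun ω => Fin.prod_univ_eq_prod_range (fun k => F (Γ k ω, U k ω)) N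
    have key := integral_comp_prodMk_of_indepFun (P := P)
      ((measurable_pi_lambda _ hΓ).prodMk (measurable_pi_lambda _ fun k : Fin N => hU k)) (hU N)
      (hind N)
      (F := fun p : ((ℕ → ℝ) × (Fin N → β)) × β =>
        (∏ k : Fin N, F (p.1.1 k, p.1.2 k)) * (F (p.1.1 N, p.2) * h p.1.1))
      (Measurable.stronglyMeasurable (by fun_prop)) ?_
    · simp only [e1] at key
      simp_rw [Finset.prod_range_succ, mul_assoc]
      rw [key]
      have e2 : ∀ ω, ∫ x, (∏ k ∈ Finset.range N, F (Γ k ω, U k ω)) *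
          (F (Γ N ω, x) * h fun k => Γ k ω) ∂(P.map (U N)) =
          (∏ k ∈ Finset.range N, F (Γ k ω, U k ω)) * (g (Γ N ω) * h fun k => Γ k ω) := by
        intro ω
        rw [integral_const_mul, integral_mul_const, integral_map (f := fun x => F (Γ N ω, x)) (hU N).aemeasurable
          (hF.comp_measurable measurable_prodMk_left).aestronglyMeasurable, hg]
      simp_rw [e2]
      refine ih (h := fun x => g (x N) * h x) (Measurable.stronglyMeasurable (by fun_prop))
        fun x => ?_
      rw [norm_mul]
      exact mul_le_one₀ (hg1 _) (norm_nonneg _) (hh1 _)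
    · refine Integrable.of_bound (C := 1) (Measurable.aestronglyMeasurable ?_)
        (ae_of_all _ fun ω => ?_)
      · fun_prop
      · rw [norm_mul, norm_mul, norm_prod]
        exact mul_le_one₀ (Finset.prod_le_one (fun _ _ => norm_nonneg _) fun _ _ => hF1 _)
          (by positivity) (mul_le_one₀ (hF1 _) (norm_nonneg _) (hh1 _))

end Marks

/-! ### The Laplace exponent of a stable law -/

section StableExponent

/-- The integral `∫₀^∞ (1 - exp (-y ^ (-2 / α) / 2)) dy`: the constant in the exponent of the
symmetric `α`-stable law obtained by summing `Γₙ ^ (-1 / α) Gₙ Vₙ`. -/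
noncomputable def stableConst (α : ℝ) : ℝ :=
  ∫ y in Set.Ioi (0 : ℝ), (1 - Real.exp (-(y ^ (-1 / α)) ^ 2 / 2))

variable {α : ℝ}

theorem one_sub_exp_neg_sq_nonneg (a : ℝ) : 0 ≤ 1 - Real.exp (-a ^ 2 / 2) :=
  sub_nonneg.2 (Real.exp_le_one_iff.2 (by nlinarith [sq_nonneg a]))

theorem one_sub_exp_neg_sq_le_one (a : ℝ) : 1 - Real.exp (-a ^ 2 / 2) ≤ 1 :=
  sub_le_self _ (Real.exp_nonneg _)

theorem stableConst_nonneg : 0 ≤ stableConst α :=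
  integral_nonneg fun _ => one_sub_exp_neg_sq_nonneg _

theorem integrableOn_stable (hα : 0 < α) (hα2 : α < 2) :
    IntegrableOn (fun y : ℝ => 1 - Real.exp (-(y ^ (-1 / α)) ^ 2 / 2)) (Set.Ioi 0) := by
  have hm : Measurable (fun y : ℝ => 1 - Real.exp (-(y ^ (-1 / α)) ^ 2 / 2)) := by fun_prop
  rw [← Set.Ioc_union_Ioi_eq_Ioi zero_le_one, integrableOn_union]
  constructor
  · refine Integrable.of_bound (C := 1) hm.aestronglyMeasurable (ae_of_all _ fun y => ?_)
    rw [Real.norm_of_nonneg (one_sub_exp_neg_sq_nonneg _)]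
    exact one_sub_exp_neg_sq_le_one _
  · have h1 : -2 / α < -1 := by rw [div_lt_iff₀ hα]; linarith
    refine (integrableOn_Ioi_rpow_of_lt h1 zero_lt_one).mono' hm.aestronglyMeasurable ?_
    filter_upwards [ae_restrict_mem measurableSet_Ioi] with y hy
    have hy0 : 0 < y := zero_lt_one.trans hy
    rw [Real.norm_of_nonneg (one_sub_exp_neg_sq_nonneg _)]
    have h2 : (y ^ (-1 / α)) ^ 2 = y ^ (-2 / α) := by
      rw [← Real.rpow_natCast, ← Real.rpow_mul hy0.le]
      congr 1
      push_cast
      ring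
    rw [h2]
    have := Real.add_one_le_exp (-y ^ (-2 / α) / 2)
    have h3 : 0 ≤ y ^ (-2 / α) := Real.rpow_nonneg hy0.le _
    linarith

theorem stable_scaling (hα : 0 < α) {v y : ℝ} (hv : v ≠ 0) (hy : 0 < y) :
    ((|v| ^ α * y) ^ (-1 / α) * v) ^ 2 = (y ^ (-1 / α)) ^ 2 := by
  have hv' : 0 < |v| := abs_pos.2 hv
  rw [Real.mul_rpow (Real.rpow_nonneg hv'.le _) hy.le, ← Real.rpow_mul hv'.le]
  have : α * (-1 / α) = -1 := by field_simp
  rw [this, Real.rpow_neg_one]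
  have h2 := sq_abs v
  field_simp
  nlinarith [h2]

theorem integral_stable_scaled (hα : 0 < α) (v : ℝ) :
    ∫ x in Set.Ioi (0 : ℝ), (1 - Real.exp (-(x ^ (-1 / α) * v) ^ 2 / 2)) =
      |v| ^ α * stableConst α := by
  rcases eq_or_ne v 0 with rfl | hv
  · simp [Real.zero_rpow hα.ne']
  · have hb : 0 < |v| ^ α := Real.rpow_pos_of_pos (abs_pos.2 hv) _
    have h := integral_comp_mul_left_Ioi'
      (fun x : ℝ => 1 - Real.exp (-(x ^ (-1 / α) * v) ^ 2 / 2)) 0 hb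
    rw [mul_zero] at h
    rw [← h, stableConst, smul_eq_mul]
    congr 1
    refine setIntegral_congr_fun measurableSet_Ioi fun y hy => ?_
    simp only [stable_scaling hα hv hy]

theorem integrableOn_stable_scaled (hα : 0 < α) (hα2 : α < 2) (v : ℝ) :
    IntegrableOn (fun x : ℝ => 1 - Real.exp (-(x ^ (-1 / α) * v) ^ 2 / 2)) (Set.Ioi 0) := by
  rcases eq_or_ne v 0 with rfl | hv
  · simp
  · have hb : 0 < |v| ^ α := Real.rpow_pos_of_pos (abs_pos.2 hv) _
    have h := integrableOn_Ioi_comp_mul_left_iff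
      (fun x : ℝ => 1 - Real.exp (-(x ^ (-1 / α) * v) ^ 2 / 2)) 0 hb
    rw [mul_zero] at h
    refine h.1 ((integrableOn_stable hα hα2).congr_fun (fun y hy => ?_) measurableSet_Ioi)
    simp only [stable_scaling hα hv hy]

variable {Ω : Type*} [MeasurableSpace Ω] {P : Measure Ω}

/-- The Laplace transform of `(x ^ (-1 / α) W) ^ 2 / 2`, as a function of the point `x`. -/
noncomputable def markLaplace (P : Measure Ω) (α : ℝ) (W : Ω → ℝ) (x : ℝ) : ℝ :=
  ∫ ω, Real.exp (-(x ^ (-1 / α) * W ω) ^ 2 / 2) ∂P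

theorem markLaplace_nonneg (W : Ω → ℝ) (x : ℝ) : 0 ≤ markLaplace P α W x :=
  integral_nonneg fun _ => Real.exp_nonneg _

variable [IsProbabilityMeasure P]

theorem integrable_exp_neg_sq {W : Ω → ℝ} (hW : Measurable W) :
    Integrable (fun ω => Real.exp (-W ω ^ 2 / 2)) P :=
  Integrable.of_bound (C := 1) (Measurable.aestronglyMeasurable (by fun_prop))
    (ae_of_all _ fun ω => by
      rw [Real.norm_of_nonneg (Real.exp_nonneg _)]
      linarith [one_sub_exp_neg_sq_nonneg (W ω)])

theorem one_sub_markLaplace {W : Ω → ℝ} (hW : Measurable W) (x : ℝ) :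
    1 - markLaplace P α W x = ∫ ω, (1 - Real.exp (-(x ^ (-1 / α) * W ω) ^ 2 / 2)) ∂P := by
  rw [integral_sub (integrable_const _) (integrable_exp_neg_sq (by fun_prop)), markLaplace]
  simp

theorem markLaplace_le_one {W : Ω → ℝ} (hW : Measurable W) (x : ℝ) :
    markLaplace P α W x ≤ 1 := by
  rw [← sub_nonneg, one_sub_markLaplace hW]
  exact integral_nonneg fun _ => one_sub_exp_neg_sq_nonneg _

theorem continuousOn_markLaplace {W : Ω → ℝ} (hW : Measurable W) :
    ContinuousOn (markLaplace P α W) (Set.Ioi 0) := by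
  refine continuousOn_of_dominated (bound := fun _ => 1)
    (fun x _ => Measurable.aestronglyMeasurable (by fun_prop)) (fun x _ => ae_of_all _ fun ω => ?_)
    (integrable_const _) (ae_of_all _ fun ω => ?_)
  · rw [Real.norm_of_nonneg (Real.exp_nonneg _)]
    linarith [one_sub_exp_neg_sq_nonneg (x ^ (-1 / α) * W ω)]
  · have : ContinuousOn (fun x : ℝ => x ^ (-1 / α)) (Set.Ioi 0) :=
      continuousOn_id.rpow_const fun x hx => Or.inl (Set.mem_Ioi.1 hx).ne'
    fun_prop

theorem lintegral_one_sub_markLaplace (hα : 0 < α) (hα2 : α < 2) {W : Ω → ℝ}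
    (hW : Measurable W) :
    ∫⁻ x in Set.Ioi 0, ENNReal.ofReal (1 - markLaplace P α W x) =
      ENNReal.ofReal (stableConst α) * ∫⁻ ω, ‖W ω‖ₑ ^ α ∂P := by
  have h1 : ∀ x, ENNReal.ofReal (1 - markLaplace P α W x) =
      ∫⁻ ω, ENNReal.ofReal (1 - Real.exp (-(x ^ (-1 / α) * W ω) ^ 2 / 2)) ∂P := fun x => by
    rw [one_sub_markLaplace hW]
    exact ofReal_integral_eq_lintegral_ofReal
      ((integrable_const _).sub (integrable_exp_neg_sq (by fun_prop)))
      (ae_of_all _ fun _ => one_sub_exp_neg_sq_nonneg _)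
  simp_rw [h1]
  rw [lintegral_lintegral_swap (by
    refine Measurable.aemeasurable ?_
    simp only [Function.uncurry_def]
    fun_prop), ← lintegral_const_mul _ (by fun_prop)]
  refine lintegral_congr fun ω => ?_
  rw [← ofReal_integral_eq_lintegral_ofReal (integrableOn_stable_scaled hα hα2 (W ω))
    (ae_of_all _ fun _ => one_sub_exp_neg_sq_nonneg _), integral_stable_scaled hα,
    mul_comm, ENNReal.ofReal_mul stableConst_nonneg,
    Real.enorm_eq_ofReal_abs, ENNReal.ofReal_rpow_of_nonneg (abs_nonneg _) hα.le]

theorem integrableOn_one_sub_markLaplace (hα : 0 < α) (hα2 : α < 2) {W : Ω → ℝ}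
    (hW : Measurable W) (hWα : ∫⁻ ω, ‖W ω‖ₑ ^ α ∂P ≠ ∞) :
    IntegrableOn (fun x => 1 - markLaplace P α W x) (Set.Ioi 0) := by
  refine ⟨(continuousOn_const.sub (continuousOn_markLaplace hW)).aestronglyMeasurable
    measurableSet_Ioi, ?_⟩
  rw [hasFiniteIntegral_iff_ofReal (ae_of_all _ fun x => sub_nonneg.2 (markLaplace_le_one hW x)),
    lintegral_one_sub_markLaplace hα hα2 hW]
  exact ENNReal.mul_lt_top ENNReal.ofReal_lt_top hWα.lt_top

theorem integral_one_sub_markLaplace (hα : 0 < α) (hα2 : α < 2) {W : Ω → ℝ}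
    (hW : Measurable W) (hWα : ∫⁻ ω, ‖W ω‖ₑ ^ α ∂P ≠ ∞) :
    ∫ x in Set.Ioi 0, (1 - markLaplace P α W x) =
      stableConst α * (∫⁻ ω, ‖W ω‖ₑ ^ α ∂P).toReal := by
  rw [integral_eq_lintegral_of_nonneg_ae
    (ae_of_all _ fun x => sub_nonneg.2 (markLaplace_le_one hW x))
    (integrableOn_one_sub_markLaplace hα hα2 hW hWα).1, lintegral_one_sub_markLaplace hα hα2 hW,
    ENNReal.toReal_mul, ENNReal.toReal_ofReal stableConst_nonneg]

end StableExponent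

/-! ### The stable series -/

section StableSeries

variable {Ω : Type*} [MeasurableSpace Ω] {P : Measure Ω}

/-- The data of the series `∑ Γₙ ^ (-1 / α) Gₙ Vₙ`: Poisson arrival times `Γ`, standard normal
coefficients `G` and identically distributed marks `V` with a finite moment of order `α`, with the
independence relations that are used. That the marks are independent of one another is part of
`indep_marks`. -/
structure IsStableSeriesData (P : Measure Ω) (α : ℝ) (Γ G V : ℕ → Ω → ℝ) : Prop where
  arrival : IsPoissonArrivalTimes P Γ
  measurable_G : ∀ n, Measurable (G n)
  measurable_V : ∀ n, Measurable (V n)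
  law_G : ∀ n, HasLaw (G n) (gaussianReal 0 1) P
  identDistrib_V : ∀ n, IdentDistrib (V n) (V 0) P P
  moment : ∫⁻ ω, ‖V 0 ω‖ₑ ^ α ∂P ≠ ∞
  /-- the pair `(G n, V n)` is independent of the arrival times and of the earlier pairs -/
  indep_marks : ∀ n, IndepFun
    (fun ω => ((fun k => Γ k ω), fun k : Fin n => (G k ω, V k ω))) (fun ω => (G n ω, V n ω)) P
  indep_pair : ∀ n, IndepFun (V n) (G n) P
  iIndep_G : iIndepFun G P
  indep_G : IndepFun (fun ω => ((fun k => Γ k ω), fun k => V k ω)) (fun ω n => G n ω) P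

theorem lintegral_enorm_const_mul_rpow {α : ℝ} (hα : 0 < α) (c : ℝ) (W : Ω → ℝ) (hW : Measurable W) :
    ∫⁻ ω, ‖c * W ω‖ₑ ^ α ∂P = ‖c‖ₑ ^ α * ∫⁻ ω, ‖W ω‖ₑ ^ α ∂P := by
  rw [← lintegral_const_mul _ (by fun_prop)]
  refine lintegral_congr fun ω => ?_
  rw [enorm_mul, ENNReal.mul_rpow_of_nonneg _ _ hα.le]

variable [IsProbabilityMeasure P] {α : ℝ} {Γ G V : ℕ → Ω → ℝ}

/-- The Laplace transform of the quadratic variation `∑ (Γₙ ^ (-1 / α) c Vₙ) ^ 2`. -/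
theorem IsStableSeriesData.tendsto_integral_exp_sum_sq (h : IsStableSeriesData P α Γ G V)
    (hα : 0 < α) (hα2 : α < 2) (c : ℝ) :
    Tendsto (fun N => ∫ ω, Real.exp (-c ^ 2 / 2 *
        ∑ n ∈ Finset.range N, (Γ n ω ^ (-1 / α) * V n ω) ^ 2) ∂P) atTop
      (𝓝 (Real.exp (-(stableConst α * (‖c‖ₑ ^ α * ∫⁻ ω, ‖V 0 ω‖ₑ ^ α ∂P).toReal)))) := by
  have hVm := h.measurable_V
  have hW : Measurable (fun ω => c * V 0 ω) := (hVm 0).const_mul c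
  have hmom : ∫⁻ ω, ‖c * V 0 ω‖ₑ ^ α ∂P ≠ ∞ := by
    rw [lintegral_enorm_const_mul_rpow hα c _ (hVm 0)]
    exact ENNReal.mul_ne_top (ENNReal.rpow_ne_top_of_nonneg hα.le enorm_ne_top) h.moment
  have key := tendsto_integral_prod_arrival h.arrival (continuousOn_markLaplace hW)
    (fun x _ => markLaplace_nonneg _ x) (fun x _ => markLaplace_le_one hW x)
    (integrableOn_one_sub_markLaplace hα hα2 hW hmom)
  rw [integral_one_sub_markLaplace hα hα2 hW hmom,
    lintegral_enorm_const_mul_rpow hα c _ (hVm 0)] at key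
  refine key.congr fun N => ?_
  have hm := integral_prod_marks (𝕜 := ℝ) h.arrival.measurable
    (fun n => (h.measurable_G n).prodMk (hVm n)) h.indep_marks
    (F := fun p => Real.exp (-(p.1 ^ (-1 / α) * (c * p.2.2)) ^ 2 / 2))
    (g := markLaplace P α fun ω => c * V 0 ω)
    (Measurable.stronglyMeasurable (by fun_prop)) (fun z => ?_) (fun n x => ?_) N
    (h := fun _ => 1) stronglyMeasurable_const (by simp)
  · simp only [mul_one] at hm
    rw [← hm]
    refine integral_congr_ae (ae_of_all _ fun ω => ?_)
    simp only
    rw [← Real.exp_sum, Finset.mul_sum]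
    congr 1
    exact Finset.sum_congr rfl fun k _ => by ring
  · rw [Real.norm_of_nonneg (Real.exp_nonneg _)]
    linarith [one_sub_exp_neg_sq_nonneg (z.1 ^ (-1 / α) * (c * z.2.2))]
  · exact ((h.identDistrib_V n).comp
      (u := fun v => Real.exp (-(x ^ (-1 / α) * (c * v)) ^ 2 / 2)) (by fun_prop)).integral_eq

theorem IsStableSeriesData.ae_summable_sq (h : IsStableSeriesData P α Γ G V)
    (hα : 0 < α) (hα2 : α < 2) :
    ∀ᵐ ω ∂P, Summable fun n => (Γ n ω ^ (-1 / α) * V n ω) ^ 2 := by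
  classical
  have hVm := h.measurable_V
  have hΓm := h.arrival.measurable
  -- the limit of `exp (-c ^ 2 / 2 * S N)`, where `S N` are the partial sums
  set L : ℝ → Ω → ℝ := fun c ω => if Summable (fun n => (Γ n ω ^ (-1 / α) * V n ω) ^ 2) then
    Real.exp (-c ^ 2 / 2 * ∑' n, (Γ n ω ^ (-1 / α) * V n ω) ^ 2) else 0 with hL
  have hexp1 : ∀ (c : ℝ) (N : ℕ) ω, ‖Real.exp (-c ^ 2 / 2 *
      ∑ n ∈ Finset.range N, (Γ n ω ^ (-1 / α) * V n ω) ^ 2)‖ ≤ 1 := fun c N ω => by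
    rw [Real.norm_of_nonneg (Real.exp_nonneg _), Real.exp_le_one_iff]
    have : 0 ≤ ∑ n ∈ Finset.range N, (Γ n ω ^ (-1 / α) * V n ω) ^ 2 :=
      Finset.sum_nonneg fun _ _ => sq_nonneg _
    nlinarith [mul_nonneg (sq_nonneg c) this]
  have hlim : ∀ c, c ≠ 0 → ∀ ω, Tendsto (fun N => Real.exp (-c ^ 2 / 2 *
      ∑ n ∈ Finset.range N, (Γ n ω ^ (-1 / α) * V n ω) ^ 2)) atTop (𝓝 (L c ω)) := by
    intro c hc ω
    by_cases hs : Summable (fun n => (Γ n ω ^ (-1 / α) * V n ω) ^ 2)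
    · simp only [hL, hs, if_true]
      exact (hs.hasSum.tendsto_sum_nat.const_mul _).rexp
    · simp only [hL, hs, if_false]
      refine Real.tendsto_exp_atBot.comp ?_
      have hc2 : -c ^ 2 / 2 < 0 := by have := sq_pos_of_ne_zero hc; linarith
      exact (((not_summable_iff_tendsto_nat_atTop_of_nonneg fun n => sq_nonneg _).1
        hs)).const_mul_atTop_of_neg hc2
  have hSm : ∀ (c : ℝ) (N : ℕ), AEStronglyMeasurable (fun ω => Real.exp (-c ^ 2 / 2 *
      ∑ n ∈ Finset.range N, (Γ n ω ^ (-1 / α) * V n ω) ^ 2)) P := fun c N =>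
    Measurable.aestronglyMeasurable (by fun_prop)
  have hLm : ∀ c, c ≠ 0 → AEStronglyMeasurable (L c) P := fun c hc =>
    aestronglyMeasurable_of_tendsto_ae atTop (hSm c) (ae_of_all _ (hlim c hc))
  have hLint : ∀ c, c ≠ 0 → ∫ ω, L c ω ∂P =
      Real.exp (-(stableConst α * (‖c‖ₑ ^ α * ∫⁻ ω, ‖V 0 ω‖ₑ ^ α ∂P).toReal)) := by
    intro c hc
    refine tendsto_nhds_unique ?_ (h.tendsto_integral_exp_sum_sq hα hα2 c)
    exact tendsto_integral_of_dominated_convergence (fun _ => 1) (hSm c) (integrable_const _)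
      (fun N => ae_of_all _ (hexp1 c N)) (ae_of_all _ (hlim c hc))
  -- as `c → 0`, `L c` tends to the indicator of the event that the series converges
  set c : ℕ → ℝ := fun m => 1 / ((m : ℝ) + 1) with hcdef
  have hc0 : ∀ m, c m ≠ 0 := fun m => by positivity
  have hct : Tendsto c atTop (𝓝 0) := tendsto_one_div_add_atTop_nhds_zero_nat
  have hL0 : ∀ ω, Tendsto (fun m => L (c m) ω) atTop (𝓝 (L 0 ω)) := by
    intro ω
    by_cases hs : Summable (fun n => (Γ n ω ^ (-1 / α) * V n ω) ^ 2)
    · simp only [hL, hs, if_true]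
      exact (((hct.pow 2).neg.div_const 2).mul_const _).rexp
    · simp only [hL, hs, if_false]
      exact tendsto_const_nhds
  have hL01 : ∀ c ω, 0 ≤ L c ω ∧ L c ω ≤ 1 := by
    intro c ω
    by_cases hs : Summable (fun n => (Γ n ω ^ (-1 / α) * V n ω) ^ 2)
    · simp only [hL, hs, if_true]
      refine ⟨Real.exp_nonneg _, Real.exp_le_one_iff.2 ?_⟩
      have : 0 ≤ ∑' n, (Γ n ω ^ (-1 / α) * V n ω) ^ 2 := tsum_nonneg fun n => sq_nonneg _
      nlinarith [mul_nonneg (sq_nonneg c) this]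
    · simp [hL, hs]
  have hLnorm : ∀ c ω, ‖L c ω‖ ≤ 1 := fun c ω => by
    rw [Real.norm_of_nonneg (hL01 c ω).1]; exact (hL01 c ω).2
  have hL0m : AEStronglyMeasurable (L 0) P :=
    aestronglyMeasurable_of_tendsto_ae atTop (fun m => hLm _ (hc0 m)) (ae_of_all _ hL0)
  have hI : ∫ ω, L 0 ω ∂P = 1 := by
    have h1 : Tendsto (fun m => ∫ ω, L (c m) ω ∂P) atTop (𝓝 (∫ ω, L 0 ω ∂P)) :=
      tendsto_integral_of_dominated_convergence (fun _ => 1) (fun m => hLm _ (hc0 m))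
        (integrable_const _) (fun m => ae_of_all _ (hLnorm _)) (ae_of_all _ hL0)
    refine tendsto_nhds_unique h1 ?_
    simp_rw [fun m => hLint (c m) (hc0 m)]
    have h2 : ∀ m, (‖c m‖ₑ ^ α * ∫⁻ ω, ‖V 0 ω‖ₑ ^ α ∂P).toReal =
        (c m) ^ α * (∫⁻ ω, ‖V 0 ω‖ₑ ^ α ∂P).toReal := fun m => by
      rw [ENNReal.toReal_mul, ← ENNReal.toReal_rpow, toReal_enorm,
        Real.norm_of_nonneg (by positivity)]
    simp_rw [h2]
    have h3 : Tendsto (fun m => c m ^ α) atTop (𝓝 0) := by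
      have := hct.rpow_const (p := α) (Or.inr hα.le)
      rwa [Real.zero_rpow hα.ne'] at this
    have := ((h3.mul_const (∫⁻ ω, ‖V 0 ω‖ₑ ^ α ∂P).toReal).const_mul (stableConst α)).neg.rexp
    simpa using this
  have hL0int : Integrable (L 0) P := Integrable.of_bound hL0m 1 (ae_of_all _ (hLnorm 0))
  have hzero : ∫ ω, (1 - L 0 ω) ∂P = 0 := by
    rw [integral_sub (integrable_const _) hL0int, hI]; simp
  have := (integral_eq_zero_iff_of_nonneg (f := fun ω => 1 - L 0 ω)
    (fun ω => sub_nonneg.2 (hL01 0 ω).2) ((integrable_const _).sub hL0int)).1 hzero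
  filter_upwards [this] with ω hω
  by_contra hs
  simp [hL, hs] at hω

theorem IsStableSeriesData.ae_exists_tendsto (h : IsStableSeriesData P α Γ G V)
    (hα : 0 < α) (hα2 : α < 2) :
    ∀ᵐ ω ∂P, ∃ y, Tendsto (fun N => ∑ n ∈ Finset.range N, Γ n ω ^ (-1 / α) * G n ω * V n ω)
      atTop (𝓝 y) := by
  have hVm := h.measurable_V
  have hΓm := h.arrival.measurable
  have hCG : IndepFun (fun ω n => Γ n ω ^ (-1 / α) * V n ω) (fun ω n => G n ω) P :=
    h.indep_G.comp (φ := fun p : (ℕ → ℝ) × (ℕ → ℝ) => fun n => p.1 n ^ (-1 / α) * p.2 n)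
      (ψ := id) (measurable_pi_lambda _ fun n => by fun_prop) measurable_id
  filter_upwards [ae_exists_tendsto_sum_mul_gaussian_of_indepFun h.measurable_G
    (C := fun n ω => Γ n ω ^ (-1 / α) * V n ω) (fun n => by fun_prop) h.law_G h.iIndep_G hCG
    (h.ae_summable_sq hα hα2)] with ω hω
  simpa only [mul_right_comm] using hω

open Complex in
/-- The sum of the series is a symmetric `α`-stable variable, with scale determined by the moment
of order `α` of the marks. -/
theorem IsStableSeriesData.integral_exp_mul_I (h : IsStableSeriesData P α Γ G V)
    (hα : 0 < α) (hα2 : α < 2) {S : Ω → ℝ}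
    (hS : ∀ᵐ ω ∂P, Tendsto (fun N => ∑ n ∈ Finset.range N, Γ n ω ^ (-1 / α) * G n ω * V n ω)
      atTop (𝓝 (S ω))) :
    ∫ ω, Complex.exp (S ω * I) ∂P =
      (Real.exp (-(stableConst α * (∫⁻ ω, ‖V 0 ω‖ₑ ^ α ∂P).toReal)) : ℂ) := by
  have hVm := h.measurable_V
  have hΓm := h.arrival.measurable
  have hGm := h.measurable_G
  have key := tendsto_integral_prod_arrival h.arrival (continuousOn_markLaplace (hVm 0))
    (fun x _ => markLaplace_nonneg _ x) (fun x _ => markLaplace_le_one (hVm 0) x)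
    (integrableOn_one_sub_markLaplace hα hα2 (hVm 0) h.moment)
  rw [integral_one_sub_markLaplace hα hα2 (hVm 0) h.moment] at key
  have key2 := (Complex.continuous_ofReal.tendsto _).comp key
  refine tendsto_nhds_unique ?_ key2
  have hlim : Tendsto (fun N => ∫ ω, Complex.exp
      ((∑ n ∈ Finset.range N, Γ n ω ^ (-1 / α) * G n ω * V n ω : ℝ) * I) ∂P) atTop
      (𝓝 (∫ ω, Complex.exp (S ω * I) ∂P)) := by
    refine tendsto_integral_of_dominated_convergence (fun _ => 1)
      (fun N => Measurable.aestronglyMeasurable (by fun_prop)) (integrable_const _)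
      (fun N => ae_of_all _ fun ω => by rw [Complex.norm_exp_ofReal_mul_I]) ?_
    filter_upwards [hS] with ω hω
    exact (((Complex.continuous_ofReal.tendsto _).comp hω).mul_const I).cexp
  refine hlim.congr fun N => ?_
  have hm := integral_prod_marks (𝕜 := ℂ) hΓm
    (fun n => (hGm n).prodMk (hVm n)) h.indep_marks
    (F := fun p => Complex.exp ((p.1 ^ (-1 / α) * p.2.1 * p.2.2 : ℝ) * I))
    (g := fun x => (markLaplace P α (V 0) x : ℂ))
    (Measurable.stronglyMeasurable (by fun_prop)) (fun z => ?_) (fun n x => ?_) N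
    (h := fun _ => 1) stronglyMeasurable_const (by simp)
  · simp only [mul_one] at hm
    have e : ∀ ω, Complex.exp
        ((∑ n ∈ Finset.range N, Γ n ω ^ (-1 / α) * G n ω * V n ω : ℝ) * I) =
        ∏ n ∈ Finset.range N, Complex.exp ((Γ n ω ^ (-1 / α) * G n ω * V n ω : ℝ) * I) := by
      intro ω
      rw [← Complex.exp_sum, Complex.ofReal_sum, Finset.sum_mul]
    simp_rw [e]
    rw [hm, Function.comp_apply, ← integral_complex_ofReal]
    simp
  · rw [Complex.norm_exp_ofReal_mul_I]
  · have e1 := integral_comp_prodMk_of_indepFun (hVm n) (hGm n) (h.indep_pair n)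
      (F := fun p : ℝ × ℝ => Complex.exp ((x ^ (-1 / α) * p.2 * p.1 : ℝ) * I))
      (Measurable.stronglyMeasurable (by fun_prop))
      (Integrable.of_bound (C := 1) (Measurable.aestronglyMeasurable (by fun_prop))
        (ae_of_all _ fun ω => by rw [Complex.norm_exp_ofReal_mul_I]))
    simp only at e1
    rw [e1, (h.law_G n).map_eq]
    have e2 : ∀ ω, ∫ u, Complex.exp ((x ^ (-1 / α) * u * V n ω : ℝ) * I) ∂(gaussianReal 0 1) =
        ((Real.exp (-(x ^ (-1 / α) * V n ω) ^ 2 / 2) : ℝ) : ℂ) := by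
      intro ω
      have := charFun_gaussianReal (μ := 0) (v := 1) (x ^ (-1 / α) * V n ω)
      rw [charFun_apply_real] at this
      convert! this using 1
      · refine integral_congr_ae (ae_of_all _ fun u => ?_)
        simp only
        congr 1
        push_cast
        ring
      · push_cast
        congr 1
        simp
        ring
    simp_rw [e2]
    rw [integral_complex_ofReal]
    congr 1
    exact ((h.identDistrib_V n).comp
      (u := fun v => Real.exp (-(x ^ (-1 / α) * v) ^ 2 / 2)) (by fun_prop)).integral_eq

end StableSeries

/-! ### Moments of the running maximum of a continuous Gaussian process -/

section GaussianSup

open ProbabilityTheory.Fernique in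
/-- Fernique's theorem for centred Gaussian measures, with a bound on the fourth moment that
depends only on the radius of a ball of measure at least `3 / 4`. -/
theorem exists_lintegral_enorm_pow_four_le_of_isGaussian {a : ℝ} (ha : 0 < a) :
    ∃ C : ℝ≥0, ∀ (ι : Type) [Fintype ι] (μ : Measure (ι → ℝ)) [IsGaussian μ], ∫ x, x ∂μ = 0 →
      3 / 4 ≤ μ {x | ‖x‖ ≤ a} → ∫⁻ x, ‖x‖ₑ ^ 4 ∂μ ≤ C := by
  have hc_gt : (2 : ℝ≥0∞)⁻¹ < 3 / 4 := by
    rw [← ENNReal.toReal_lt_toReal (by simp) (ENNReal.div_ne_top (by simp) (by simp))]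
    simp; norm_num
  have hc_lt : (3 / 4 : ℝ≥0∞) < 1 := by
    rw [← ENNReal.toReal_lt_toReal (ENNReal.div_ne_top (by simp) (by simp)) (by simp)]
    simp; norm_num
  have hratio : ((3 / 4 : ℝ≥0∞) / (1 - 3 / 4)).toReal = 3 := by
    rw [ENNReal.toReal_div, ENNReal.toReal_sub_of_le hc_lt.le (by simp)]
    simp; norm_num
  set D : ℝ≥0∞ := ENNReal.ofReal (Real.exp (logRatio (3 / 4))) +
    ∑' n : ℕ, ENNReal.ofReal (Real.exp
      (-2⁻¹ * Real.log ((3 / 4 : ℝ≥0∞) / (1 - 3 / 4)).toReal * 2 ^ n)) with hD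
  have hDfin : D ≠ ∞ := by
    refine ENNReal.add_ne_top.2 ⟨ENNReal.ofReal_ne_top, ?_⟩
    refine Summable.tsum_ofReal_ne_top ?_
    refine Real.summable_exp_nat_mul_of_ge ?_ (fun i ↦ mod_cast (Nat.lt_pow_self (by simp)).le)
    rw [hratio]
    exact mul_neg_of_neg_of_pos (by norm_num) (Real.log_pos (by norm_num))
  set r : ℝ := logRatio (3 / 4) * a⁻¹ ^ 2 with hr
  have hr0 : 0 < r := mul_pos (logRatio_pos hc_gt hc_lt) (by positivity)
  have hfin : ENNReal.ofReal (2 / r ^ 2) * D ≠ ∞ := ENNReal.mul_ne_top ENNReal.ofReal_ne_top hDfin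
  refine ⟨(ENNReal.ofReal (2 / r ^ 2) * D).toNNReal, fun ι _ μ _ hμ0 hμa => ?_⟩
  rw [ENNReal.coe_toNNReal hfin]
  have h1 := lintegral_exp_mul_sq_norm_le_of_map_rotation_eq_self
    (IsGaussian.map_rotation_eq_self (μ := μ) hμ0 (-(Real.pi / 4))) hμa hc_gt
  calc ∫⁻ x, ‖x‖ₑ ^ 4 ∂μ
      ≤ ∫⁻ x, ENNReal.ofReal (2 / r ^ 2) * ENNReal.ofReal (Real.exp (r * ‖x‖ ^ 2)) ∂μ := by
        refine lintegral_mono fun x => ?_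
        rw [← ENNReal.ofReal_mul (by positivity), ← ofReal_norm, ← ENNReal.ofReal_pow (norm_nonneg _)]
        refine ENNReal.ofReal_le_ofReal ?_
        have h2 := Real.quadratic_le_exp_of_nonneg (x := r * ‖x‖ ^ 2) (by positivity)
        have h3 : (r * ‖x‖ ^ 2) ^ 2 / 2 ≤ Real.exp (r * ‖x‖ ^ 2) := by
          have : 0 ≤ r * ‖x‖ ^ 2 := by positivity
          linarith
        calc ‖x‖ ^ 4 = 2 / r ^ 2 * ((r * ‖x‖ ^ 2) ^ 2 / 2) := by field_simp
          _ ≤ _ := by gcongr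
    _ = ENNReal.ofReal (2 / r ^ 2) * ∫⁻ x, ENNReal.ofReal (Real.exp (r * ‖x‖ ^ 2)) ∂μ :=
        lintegral_const_mul _ (by fun_prop)
    _ ≤ ENNReal.ofReal (2 / r ^ 2) * D := by gcongr

variable {Ω : Type*} [MeasurableSpace Ω] {P : Measure Ω} [IsProbabilityMeasure P]

/-- A centred Gaussian process with continuous paths is bounded on compact intervals by a variable
with a finite fourth moment. -/
theorem exists_bound_of_isGaussianProcess {B : ℝ≥0 → Ω → ℝ} (hBm : ∀ t, Measurable (B t))
    (hB : IsGaussianProcess B P) (hB0 : ∀ t, ∫ ω, B t ω ∂P = 0)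
    (hBc : ∀ᵐ ω ∂P, Continuous fun t => B t ω) (T : ℝ≥0) :
    ∃ M : Ω → ℝ≥0∞, Measurable M ∧ (∀ᵐ ω ∂P, ∀ s ≤ T, ‖B s ω‖ₑ ≤ M ω) ∧
      ∫⁻ ω, M ω ^ 4 ∂P ≠ ∞ := by
  have : Nonempty (Set.Iic T) := ⟨⟨T, Set.mem_Iic.2 le_rfl⟩⟩
  set q : ℕ → ℝ≥0 := fun k => (TopologicalSpace.denseSeq (Set.Iic T) k : ℝ≥0) with hq
  set M : Ω → ℝ≥0∞ := fun ω => ⨆ k, ‖B (q k) ω‖ₑ with hM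
  have hMm : Measurable M := Measurable.iSup fun k => (hBm _).enorm
  have hbound : ∀ᵐ ω ∂P, ∀ s ≤ T, ‖B s ω‖ₑ ≤ M ω := by
    filter_upwards [hBc] with ω hω s hs
    have hcl : IsClosed {s : Set.Iic T | ‖B s ω‖ₑ ≤ M ω} :=
      isClosed_le ((hω.comp continuous_subtype_val).enorm) continuous_const
    have hsub : Set.range (TopologicalSpace.denseSeq (Set.Iic T)) ⊆
        {s : Set.Iic T | ‖B s ω‖ₑ ≤ M ω} := by
      rintro _ ⟨k, rfl⟩
      exact le_iSup (fun k => ‖B (q k) ω‖ₑ) k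
    have := hcl.closure_subset_iff.2 hsub
    rw [(TopologicalSpace.denseRange_denseSeq (Set.Iic T)).closure_range] at this
    exact this (Set.mem_univ (⟨s, hs⟩ : Set.Iic T))
  have hMfin : ∀ᵐ ω ∂P, M ω < ∞ := by
    filter_upwards [hBc] with ω hω
    obtain ⟨C, hC⟩ := (isCompact_Icc (a := (0 : ℝ≥0)) (b := T)).exists_bound_of_continuousOn
      hω.continuousOn
    refine (iSup_le fun k => ?_).trans_lt (ENNReal.ofReal_lt_top (r := C))
    rw [← ofReal_norm]
    exact ENNReal.ofReal_le_ofReal (hC _ ⟨zero_le, (TopologicalSpace.denseSeq (Set.Iic T) k).2⟩)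
  obtain ⟨a, ha0, ha⟩ : ∃ a : ℝ, 0 < a ∧ 3 / 4 ≤ P {ω | M ω ≤ ENNReal.ofReal a} := by
    have hmono : Monotone fun n : ℕ => {ω | M ω ≤ ENNReal.ofReal (n + 1)} := by
      intro m n hmn ω hω
      exact le_trans (Set.mem_ofPred_eq ▸ hω) (ENNReal.ofReal_le_ofReal (by gcongr))
    have ht := tendsto_measure_iUnion_atTop (μ := P) hmono
    have hU : P (⋃ n : ℕ, {ω | M ω ≤ ENNReal.ofReal (n + 1)}) = 1 := by
      rw [prob_compl_eq_zero_iff₀ (by measurability) |>.symm]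
      refine measure_mono_null ?_ hMfin
      intro ω hω hlt
      apply hω
      obtain ⟨n, hn⟩ := exists_nat_ge (M ω).toReal
      refine Set.mem_iUnion.2 ⟨n, ?_⟩
      exact (ENNReal.le_ofReal_iff_toReal_le hlt.ne (by positivity)).2 (by linarith)
    rw [hU] at ht
    have hlt : (3 / 4 : ℝ≥0∞) < 1 := by
      rw [← ENNReal.toReal_lt_toReal (ENNReal.div_ne_top (by simp) (by simp)) (by simp)]
      simp; norm_num
    obtain ⟨n, hn⟩ := (ht.eventually (lt_mem_nhds hlt)).exists
    exact ⟨n + 1, by positivity, hn.le⟩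
  obtain ⟨C, hC⟩ := exists_lintegral_enorm_pow_four_le_of_isGaussian ha0
  -- the maxima over finitely many times, to which the finite-dimensional bound applies uniformly
  set Mn : ℕ → Ω → ℝ≥0∞ := fun n ω => (Finset.range n).sup fun k => ‖B (q k) ω‖ₑ with hMn
  have hMnC : ∀ n, ∫⁻ ω, Mn n ω ^ 4 ∂P ≤ C := by
    intro n
    set I : Finset ℝ≥0 := (Finset.range n).image q with hI
    have hXm : Measurable (fun ω => I.restrict (B · ω)) := measurable_pi_lambda _ fun i => hBm i
    have : IsGaussian (P.map fun ω => I.restrict (B · ω)) := (hB.hasGaussianLaw I).isGaussian_map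
    have hmean : ∫ x, x ∂(P.map fun ω => I.restrict (B · ω)) = 0 := by
      ext i
      have h1 := (ContinuousLinearMap.proj (R := ℝ) (φ := fun _ : I => ℝ) i).integral_comp_comm
        (IsGaussian.integrable_id (μ := P.map fun ω => I.restrict (B · ω)))
      simp only [ContinuousLinearMap.proj_apply, id] at h1
      rw [← h1, integral_map hXm.aemeasurable (measurable_pi_apply i).aestronglyMeasurable]
      exact hB0 i
    have hball : 3 / 4 ≤ (P.map fun ω => I.restrict (B · ω)) {x | ‖x‖ ≤ a} := by
      rw [Measure.map_apply hXm (measurableSet_le (by fun_prop) (by fun_prop))]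
      refine ha.trans (measure_mono fun ω hω => ?_)
      have hω' : M ω ≤ ENNReal.ofReal a := hω
      refine (pi_norm_le_iff_of_nonneg ha0.le).2 fun i => ?_
      obtain ⟨k, -, hk⟩ := Finset.mem_image.1 i.2
      have : ‖B (q k) ω‖ₑ ≤ ENNReal.ofReal a := (le_iSup (fun k => ‖B (q k) ω‖ₑ) k).trans hω'
      rw [← ofReal_norm, ENNReal.ofReal_le_ofReal_iff ha0.le] at this
      rw [hk] at this
      exact this
    refine le_trans ?_ (hC I _ hmean hball)
    rw [lintegral_map (by fun_prop) hXm]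
    refine lintegral_mono fun ω => ?_
    gcongr
    refine Finset.sup_le fun k hk => ?_
    rw [← ofReal_norm, ← ofReal_norm]
    exact ENNReal.ofReal_le_ofReal
      (norm_le_pi_norm (I.restrict (B · ω)) ⟨q k, Finset.mem_image_of_mem q hk⟩)
  refine ⟨M, hMm, hbound, ne_top_of_le_ne_top (ENNReal.coe_ne_top (r := C)) ?_⟩
  have hmono : ∀ ω, Monotone fun n => Mn n ω := fun ω m n hmn =>
    Finset.sup_mono (Finset.range_mono hmn)
  have hlim : ∀ ω, Tendsto (fun n => Mn n ω) atTop (𝓝 (M ω)) := by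
    intro ω
    have h1 := tendsto_atTop_iSup (hmono ω)
    have h2 : ⨆ n, Mn n ω = M ω := by
      refine le_antisymm (iSup_le fun n => Finset.sup_le fun k _ => le_iSup (fun k => ‖B (q k) ω‖ₑ) k)
        (iSup_le fun k => ?_)
      exact (Finset.le_sup (f := fun k => ‖B (q k) ω‖ₑ) (Finset.self_mem_range_succ k)).trans
        (le_iSup (fun n => Mn n ω) (k + 1))
    rwa [h2] at h1
  have hMnm : ∀ n, Measurable (Mn n) := fun n => by
    simp only [hMn, Finset.sup_eq_iSup]
    exact Measurable.iSup fun k => Measurable.iSup fun _ => (hBm _).enorm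
  refine le_of_tendsto' (lintegral_tendsto_of_tendsto_of_monotone
    (f := fun n ω => Mn n ω ^ 4) (fun n => ((hMnm n).pow_const 4).aemeasurable)
    (ae_of_all _ fun ω m n hmn => ?_) (ae_of_all _ fun ω => ?_)) hMnC
  · exact pow_le_pow_left' (hmono ω hmn) 4
  · exact ((ENNReal.continuous_pow 4).tendsto _).comp (hlim ω)

end GaussianSup

/-! ### Linear combinations of the kernels -/

section Kernel

/-- The linear combination `∑ θ t * g (x, t)` over the times `t ∈ J`, as a function of `x`. -/
noncomputable def linComb (J : Finset ℝ≥0) (θ : ℝ≥0 → ℝ) (g : ℝ × ℝ≥0 → ℝ) (x : ℝ) : ℝ :=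
  ∑ t ∈ J, θ t * g (x, t)

variable (J : Finset ℝ≥0) (θ : ℝ≥0 → ℝ)

/-- The evaluation map is not measurable for the product σ-algebra on functions: continuity of
`x ↦ f ω (x, t)` is what makes the linear combinations jointly measurable. -/
theorem measurable_linComb {Ω : Type*} [MeasurableSpace Ω] {f : Ω → ℝ × ℝ≥0 → ℝ}
    (hf : Measurable f) (hc : ∀ ω, Continuous (f ω)) :
    Measurable fun p : Ω × ℝ => linComb J θ (f p.1) p.2 := by
  refine Finset.measurable_fun_sum _ fun t _ => Measurable.const_mul ?_ _
  have h := measurable_uncurry_of_continuous_of_measurable (u := fun (x : ℝ) ω => f ω (x, t))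
    (fun ω => (hc ω).comp (by fun_prop)) (fun x => (measurable_pi_apply (x, t)).comp hf)
  exact h.comp measurable_swap

theorem measurable_linComb_apply (x : ℝ) :
    Measurable fun g : ℝ × ℝ≥0 → ℝ => linComb J θ g x :=
  Finset.measurable_fun_sum _ fun t _ => (measurable_pi_apply (x, t)).const_mul _

theorem measurable_mul_linComb {Ω : Type*} [MeasurableSpace Ω] {f : Ω → ℝ × ℝ≥0 → ℝ}
    (hf : Measurable f) (hc : ∀ ω, Continuous (f ω)) {X : Ω → ℝ} (hX : Measurable X) {w : ℝ → ℝ}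
    (hw : Measurable w) : Measurable fun ω => w (X ω) * linComb J θ (f ω) (X ω) :=
  (hw.comp hX).mul ((measurable_linComb J θ hf hc).comp (measurable_id.prodMk hX))

theorem enorm_linComb_le (g : ℝ × ℝ≥0 → ℝ) (x : ℝ) :
    ‖linComb J θ g x‖ₑ ≤ (∑ t ∈ J, ‖θ t‖ₑ) * uniformNormOn J (fun t => g (x, t)) := by
  rw [linComb, Finset.sum_mul]
  refine (enorm_sum_le _ _).trans (Finset.sum_le_sum fun t ht => ?_)
  rw [enorm_mul]
  gcongr
  exact le_iSup₂ (f := fun (t : ℝ≥0) (_ : t ∈ (J : Set ℝ≥0)) => ‖g (x, t)‖ₑ) t ht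

variable {Ω : Type*} [MeasurableSpace Ω] {P : Measure Ω} [IsProbabilityMeasure P]
  {H ρ : ℝ} {f : ℕ → Ω → ℝ × ℝ≥0 → ℝ} {B : ℕ → ℝ≥0 → Ω → ℝ}

/-- A point charged by the kernel before time `T` is not further away than the running maximum of
the fractional Brownian motion allows. -/
theorem enorm_le_of_mem_Icc {b : ℝ≥0 → ℝ} {t T : ℝ≥0} (htT : t ≤ T) {M : ℝ≥0∞}
    (hM : ∀ s ≤ T, ‖b s‖ₑ ≤ M) {x : ℝ}
    (hx : x ∈ Set.Icc (sInf (b '' Set.Iic t) - ρ) (sSup (b '' Set.Iic t) + ρ)) :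
    ‖x‖ₑ ≤ M + ENNReal.ofReal ρ := by
  rcases eq_or_ne M ∞ with rfl | hMtop
  · simp
  have hb : ∀ s ≤ t, |b s| ≤ M.toReal := fun s hs => by
    rw [← Real.norm_eq_abs, ← toReal_enorm]
    exact ENNReal.toReal_mono hMtop (hM s (hs.trans htT))
  have hne : (b '' Set.Iic t).Nonempty := ⟨b t, t, Set.mem_Iic.2 le_rfl, rfl⟩
  have h1 : sSup (b '' Set.Iic t) ≤ M.toReal := csSup_le hne (by
    rintro _ ⟨s, hs, rfl⟩
    exact (abs_le.1 (hb s hs)).2)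
  have h2 : -M.toReal ≤ sInf (b '' Set.Iic t) := le_csInf hne (by
    rintro _ ⟨s, hs, rfl⟩
    exact (abs_le.1 (hb s hs)).1)
  have h3 : |x| ≤ M.toReal + ρ := abs_le.2 ⟨by linarith [hx.1], by linarith [hx.2]⟩
  rw [Real.enorm_eq_ofReal_abs]
  calc ENNReal.ofReal |x| ≤ ENNReal.ofReal (M.toReal + ρ) := ENNReal.ofReal_le_ofReal h3
    _ ≤ ENNReal.ofReal M.toReal + ENNReal.ofReal ρ := ENNReal.ofReal_add_le
    _ = M + ENNReal.ofReal ρ := by rw [ENNReal.ofReal_toReal hMtop]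

theorem ennreal_mul_le_sq_add_sq (a b : ℝ≥0∞) : a * b ≤ a ^ 2 + b ^ 2 := by
  rcases le_total a b with h | h
  · calc a * b ≤ b * b := by gcongr
      _ ≤ a ^ 2 + b ^ 2 := by rw [← sq]; exact le_add_self
  · calc a * b ≤ a * a := by gcongr
      _ ≤ a ^ 2 + b ^ 2 := by rw [← sq]; exact le_self_add

theorem ennreal_add_pow_four_le (a b : ℝ≥0∞) : (a + b) ^ 4 ≤ 2 ^ 4 * (a ^ 4 + b ^ 4) := by
  rcases le_total a b with h | h
  · calc (a + b) ^ 4 ≤ (b + b) ^ 4 := by gcongr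
      _ = 2 ^ 4 * b ^ 4 := by rw [← two_mul, mul_pow]
      _ ≤ _ := by gcongr; exact le_add_self
  · calc (a + b) ^ 4 ≤ (a + a) ^ 4 := by gcongr
      _ = 2 ^ 4 * a ^ 4 := by rw [← two_mul, mul_pow]
      _ ≤ _ := by gcongr; exact le_self_add

/-- The moments `E |∑ θ t f (x, t)| ^ α` are integrable in `x`: the kernel vanishes at `x` unless
the fractional Brownian motion reaches a neighbourhood of `x`, and the moments of its running
maximum make this unlikely for large `x`. -/
theorem IsKernelSequence.lintegral_lintegral_linComb_ne_top {α : ℝ} (hα : 0 < α)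
    (hf : IsKernelSequence P H ρ f B) (n : ℕ) :
    ∫⁻ x : ℝ, ∫⁻ ω, ‖linComb J θ (f n ω) x‖ₑ ^ α ∂P ≠ ∞ := by
  have hB := hf.isFBM n
  obtain ⟨M, hMm, hMb, hM4⟩ := exists_bound_of_isGaussianProcess hB.measurable
    hB.isGaussianProcess hB.mean_zero hB.continuous_paths (J.sup id)
  obtain ⟨C, hC⟩ := hf.moment_bound n J J.finite_toSet.isCompact (2 * α) (by positivity)
  set A : ℝ≥0∞ := ∑ t ∈ J, ‖θ t‖ₑ with hA
  have hAtop : A ≠ ∞ := ENNReal.sum_ne_top.2 fun t _ => enorm_ne_top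
  set R : Ω → ℝ≥0∞ := fun ω => (1 + ENNReal.ofReal ρ) + M ω with hR
  set D : ℝ≥0∞ := ∫⁻ ω, R ω ^ 4 ∂P + A ^ (2 * α) * C with hD
  have hDtop : D ≠ ∞ := by
    refine ENNReal.add_ne_top.2 ⟨?_, ENNReal.mul_ne_top
      (ENNReal.rpow_ne_top_of_nonneg (by positivity) hAtop) ENNReal.coe_ne_top⟩
    refine ne_top_of_le_ne_top ?_ (lintegral_mono fun ω =>
      ennreal_add_pow_four_le (1 + ENNReal.ofReal ρ) (M ω))
    rw [lintegral_const_mul _ (by fun_prop), lintegral_add_left (by fun_prop)]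
    refine ENNReal.mul_ne_top (by simp) (ENNReal.add_ne_top.2 ⟨?_, hM4⟩)
    simp
  have hx : ∀ x : ℝ, ∫⁻ ω, ‖linComb J θ (f n ω) x‖ₑ ^ α ∂P ≤
      ENNReal.ofReal ((1 + ‖x‖) ^ (-2 : ℝ)) * D := by
    intro x
    -- where the combination does not vanish, `1 ≤ (1 + ‖x‖) ^ (-2) * R ^ 2`; the product of `R ^ 2`
    -- with the `α`-th power is then split by `a * b ≤ a ^ 2 + b ^ 2`
    have hpt : ∀ᵐ ω ∂P, ‖linComb J θ (f n ω) x‖ₑ ^ α ≤ ENNReal.ofReal ((1 + ‖x‖) ^ (-2 : ℝ)) *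
        (R ω ^ 4 + A ^ (2 * α) * uniformNormOn J (fun t => f n ω (x, t)) ^ (2 * α)) := by
      filter_upwards [hMb, hf.support_subset n] with ω h1 h2
      by_cases hz : linComb J θ (f n ω) x = 0
      · simp [hz, hα]
      obtain ⟨t, htJ, ht⟩ : ∃ t ∈ J, f n ω (x, t) ≠ 0 := by
        by_contra! hcon
        exact hz (Finset.sum_eq_zero fun t ht => by rw [hcon t ht, mul_zero])
      have hxM := enorm_le_of_mem_Icc (b := fun s => B n s ω) (Finset.le_sup (f := id) htJ) h1
        (h2 t ht)
      have hxR : ENNReal.ofReal (1 + ‖x‖) ≤ R ω := by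
        rw [ENNReal.ofReal_add zero_le_one (norm_nonneg _), ofReal_norm, ENNReal.ofReal_one]
        calc 1 + ‖x‖ₑ ≤ 1 + (M ω + ENNReal.ofReal ρ) := by gcongr
          _ = R ω := by simp only [hR]; ring
      have hone : 1 ≤ ENNReal.ofReal ((1 + ‖x‖) ^ (-2 : ℝ)) * R ω ^ 2 := by
        calc (1 : ℝ≥0∞) = ENNReal.ofReal ((1 + ‖x‖) ^ (-2 : ℝ)) *
              ENNReal.ofReal (1 + ‖x‖) ^ 2 := by
              rw [← ENNReal.ofReal_pow (by positivity), ← ENNReal.ofReal_mul (by positivity),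
                Real.rpow_neg (by positivity), ← ENNReal.ofReal_one]
              congr 1
              have : 1 + ‖x‖ ≠ 0 := by positivity
              rw [show (2 : ℝ) = ((2 : ℕ) : ℝ) by norm_num, Real.rpow_natCast]
              field_simp
          _ ≤ _ := by gcongr
      calc ‖linComb J θ (f n ω) x‖ₑ ^ α
          ≤ (ENNReal.ofReal ((1 + ‖x‖) ^ (-2 : ℝ)) * R ω ^ 2) *
            ‖linComb J θ (f n ω) x‖ₑ ^ α := le_mul_of_one_le_left zero_le hone
        _ ≤ ENNReal.ofReal ((1 + ‖x‖) ^ (-2 : ℝ)) *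
            ((R ω ^ 2) ^ 2 + (‖linComb J θ (f n ω) x‖ₑ ^ α) ^ 2) := by
            rw [mul_assoc]
            gcongr
            exact ennreal_mul_le_sq_add_sq _ _
        _ ≤ _ := by
            refine mul_le_mul' le_rfl (add_le_add (by rw [← pow_mul]) ?_)
            rw [← ENNReal.rpow_natCast, ← ENNReal.rpow_mul, ← ENNReal.mul_rpow_of_nonneg _ _
              (by positivity), mul_comm α]
            exact ENNReal.rpow_le_rpow (enorm_linComb_le J θ (f n ω) x) (by positivity)
    refine (lintegral_mono_ae hpt).trans ?_
    rw [lintegral_const_mul' _ _ ENNReal.ofReal_ne_top, lintegral_add_left (by fun_prop),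
      lintegral_const_mul' _ _ (ENNReal.rpow_ne_top_of_nonneg (by positivity) hAtop)]
    exact mul_le_mul' le_rfl (add_le_add le_rfl (mul_le_mul' le_rfl (hC x)))
  refine ne_top_of_le_ne_top ?_ (lintegral_mono hx)
  rw [lintegral_mul_const' _ _ hDtop]
  refine ENNReal.mul_ne_top ?_ hDtop
  exact (finite_integral_one_add_norm (E := ℝ) (μ := volume) (r := 2) (by simp)).ne

/-- Integrating out the position `X` of the mark. As the `f n` are identically distributed, the
result does not depend on `n`. -/
theorem IsKernelSequence.lintegral_comp_mul_linComb (hf : IsKernelSequence P H ρ f B)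
    {X : Ω → ℝ} (hX : Measurable X) {w : ℝ → ℝ} (hw : Measurable w) (n : ℕ)
    (hind : Indep (MeasurableSpace.comap (f n) inferInstance)
      (MeasurableSpace.comap X inferInstance) P) {F : ℝ → ℝ≥0∞} (hF : Measurable F) :
    ∫⁻ ω, F (w (X ω) * linComb J θ (f n ω) (X ω)) ∂P =
      ∫⁻ x, ∫⁻ ω, F (w x * linComb J θ (f 0 ω) x) ∂P ∂(P.map X) := by
  -- `ω` itself, with the σ-algebra generated by `f n`, stands in for the random function, as the
  -- integrand is not measurable for the product σ-algebra on functions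
  have h := @lintegral_comp_prodMk_of_indepFun Ω ℝ Ω _ (MeasurableSpace.comap (f n) inferInstance)
    _ P _ id X (measurable_id'' (hf.measurable n).comap_le) hX
    ((@IndepFun_iff_Indep _ _ _ _ (MeasurableSpace.comap (f n) inferInstance) _ id X P).2
      (by rw [MeasurableSpace.comap_id]; exact hind))
    (fun p => F (w p.2 * linComb J θ (f n p.1) p.2)) ?_
  · simp only [id] at h
    rw [h]
    refine lintegral_congr fun x => ?_
    refine ((hf.identDistrib n 0).comp (u := fun g => F (w x * linComb J θ g x)) ?_).lintegral_eq
    exact hF.comp ((measurable_linComb_apply J θ x).const_mul _)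
  · exact hF.comp (Measurable.mul (hw.comp measurable_snd)
      (@measurable_linComb J θ Ω (MeasurableSpace.comap (f n) inferInstance) _
        (comap_measurable (f n)) (hf.continuous n)))

end Kernel

/-! ### Independence of the sources of randomness -/

section Sources

theorem measurable_iSup_of_mem {Ω ι β : Type*} [MeasurableSpace β] {m : ι → MeasurableSpace Ω}
    {S : Set ι} {i : ι} (hi : i ∈ S) {Y : Ω → β} (hY : Measurable[m i] Y) :
    Measurable[⨆ i ∈ S, m i] Y :=
  hY.mono (le_biSup m hi) le_rfl

theorem indepFun_of_iIndep_of_measurable_iSup {Ω : Type*} [MeasurableSpace Ω] {P : Measure Ω}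
    {ι β γ : Type*} [MeasurableSpace β] [MeasurableSpace γ] {m : ι → MeasurableSpace Ω} (hm : ∀ i, m i ≤ ‹MeasurableSpace Ω›)
    (h : iIndep m P) {S T : Set ι} (hST : Disjoint S T) {Y : Ω → β} {Z : Ω → γ}
    (hY : Measurable[⨆ i ∈ S, m i] Y) (hZ : Measurable[⨆ i ∈ T, m i] Z) : IndepFun Y Z P := by
  rw [IndepFun_iff_Indep]
  exact indep_of_indep_of_le_left (indep_of_indep_of_le_right
    (indep_iSup_of_disjoint hm h hST) hZ.comap_le) hY.comap_le

variable {Ω : Type*} {Γ G X : ℕ → Ω → ℝ} {f : ℕ → Ω → ℝ × ℝ≥0 → ℝ} {B : ℕ → ℝ≥0 → Ω → ℝ}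

theorem sources_le [MeasurableSpace Ω] (hΓ : ∀ n, Measurable (Γ n)) (hG : ∀ n, Measurable (G n))
    (hX : ∀ n, Measurable (X n)) (hf : ∀ n, Measurable (f n)) (hB : ∀ n t, Measurable (B n t)) :
    ∀ i, sources Γ G X f B i ≤ ‹MeasurableSpace Ω› := by
  rintro (_ | n | n | n)
  · exact (measurable_pi_lambda _ hΓ).comap_le
  · exact (hG n).comap_le
  · exact (hX n).comap_le
  · exact ((hf n).prodMk (measurable_pi_lambda _ (hB n))).comap_le

variable {S : Set (Unit ⊕ ℕ ⊕ ℕ ⊕ ℕ)}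

theorem measurable_arrivals_of_mem (h : .inl () ∈ S) :
    Measurable[⨆ i ∈ S, sources Γ G X f B i] (fun ω n => Γ n ω) :=
  measurable_iSup_of_mem h (comap_measurable _)

theorem measurable_G_of_mem {n : ℕ} (h : .inr (.inl n) ∈ S) :
    Measurable[⨆ i ∈ S, sources Γ G X f B i] (G n) :=
  measurable_iSup_of_mem h (comap_measurable _)

theorem measurable_X_of_mem {n : ℕ} (h : .inr (.inr (.inl n)) ∈ S) :
    Measurable[⨆ i ∈ S, sources Γ G X f B i] (X n) :=
  measurable_iSup_of_mem h (comap_measurable _)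

theorem measurable_f_of_mem {n : ℕ} (h : .inr (.inr (.inr n)) ∈ S) :
    Measurable[⨆ i ∈ S, sources Γ G X f B i] (f n) :=
  measurable_iSup_of_mem h (measurable_fst.comp
    (comap_measurable (fun ω => (f n ω, fun t => B n t ω))))

end Sources

/-! ### Finite-dimensional distributions of the series -/

section Series

theorem sum_mul_partialSum {Ω : Type*} {α : ℝ} {Γ G X : ℕ → Ω → ℝ} {f : ℕ → Ω → ℝ × ℝ≥0 → ℝ}
    {w : ℝ → ℝ} (J : Finset ℝ≥0) (θ : ℝ≥0 → ℝ) (N : ℕ) (ω : Ω) :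
    ∑ t ∈ J, θ t * partialSum α Γ G w X f N ω t = ∑ n ∈ Finset.range N,
      Γ n ω ^ (-1 / α) * G n ω * (w (X n ω) * linComb J θ (f n ω) (X n ω)) := by
  simp only [partialSum, linComb, Finset.mul_sum]
  rw [Finset.sum_comm]
  refine Finset.sum_congr rfl fun n _ => Finset.sum_congr rfl fun t _ => ?_
  ring

variable {Ω : Type*} [MeasurableSpace Ω] {P : Measure Ω} [IsProbabilityMeasure P]
  {α H ρ : ℝ} {Γ G X : ℕ → Ω → ℝ} {f : ℕ → Ω → ℝ × ℝ≥0 → ℝ} {B : ℕ → ℝ≥0 → Ω → ℝ}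
  {w : ℝ → ℝ} {ν : Measure ℝ}

/-- If the weight `w` turns the law `ν` of the positions into Lebesgue measure, in the sense that
`|w| ^ α ν` is Lebesgue measure, the moment of order `α` of the marks does not depend on `w`
and `ν`. -/
theorem isStableSeriesData_linComb (hα : 0 < α) (hΓ : IsPoissonArrivalTimes P Γ)
    (hGm : ∀ n, Measurable (G n)) (hG : ∀ n, HasLaw (G n) (gaussianReal 0 1) P)
    (hXm : ∀ n, Measurable (X n)) (hX : ∀ n, HasLaw (X n) ν P)
    (hf : IsKernelSequence P H ρ f B) (hind : MutuallyIndependent P Γ G X f B)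
    (hw : Measurable w) (hwν : ν.withDensity (fun x => ‖w x‖ₑ ^ α) = volume)
    (J : Finset ℝ≥0) (θ : ℝ≥0 → ℝ) :
    IsStableSeriesData P α Γ G (fun n ω => w (X n ω) * linComb J θ (f n ω) (X n ω)) ∧
      ∫⁻ ω, ‖w (X 0 ω) * linComb J θ (f 0 ω) (X 0 ω)‖ₑ ^ α ∂P =
        ∫⁻ x : ℝ, ∫⁻ ω, ‖linComb J θ (f 0 ω) x‖ₑ ^ α ∂P := by
  have hle := sources_le hΓ.measurable hGm hXm hf.measurable fun n => (hf.isFBM n).measurable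
  have hVm : ∀ n, Measurable fun ω => w (X n ω) * linComb J θ (f n ω) (X n ω) := fun n =>
    measurable_mul_linComb J θ (hf.measurable n) (hf.continuous n) (hXm n) hw
  have hVS : ∀ n (S : Set (Unit ⊕ ℕ ⊕ ℕ ⊕ ℕ)), .inr (.inr (.inl n)) ∈ S →
      .inr (.inr (.inr n)) ∈ S → Measurable[⨆ i ∈ S, sources Γ G X f B i]
        fun ω => w (X n ω) * linComb J θ (f n ω) (X n ω) := fun n S h1 h2 =>
    @measurable_mul_linComb J θ Ω (⨆ i ∈ S, sources Γ G X f B i) _ (measurable_f_of_mem h2)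
      (hf.continuous n) _ (measurable_X_of_mem h1) _ hw
  have hfX : ∀ n, Indep (MeasurableSpace.comap (f n) inferInstance)
      (MeasurableSpace.comap (X n) inferInstance) P := fun n => by
    rw [← IndepFun_iff_Indep]
    exact indepFun_of_iIndep_of_measurable_iSup hle hind
      (S := {.inr (.inr (.inr n))}) (T := {.inr (.inr (.inl n))}) (by simp)
      (measurable_f_of_mem rfl) (measurable_X_of_mem rfl)
  have hlaw : ∀ n (F : ℝ → ℝ≥0∞), Measurable F →
      ∫⁻ ω, F (w (X n ω) * linComb J θ (f n ω) (X n ω)) ∂P =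
        ∫⁻ x, ∫⁻ ω, F (w x * linComb J θ (f 0 ω) x) ∂P ∂ν := fun n F hF => by
    rw [hf.lintegral_comp_mul_linComb J θ (hXm n) hw n (hfX n) hF, (hX n).map_eq]
  have hmom : ∫⁻ ω, ‖w (X 0 ω) * linComb J θ (f 0 ω) (X 0 ω)‖ₑ ^ α ∂P =
      ∫⁻ x : ℝ, ∫⁻ ω, ‖linComb J θ (f 0 ω) x‖ₑ ^ α ∂P := by
    have hjm : Measurable fun p : Ω × ℝ => ‖linComb J θ (f 0 p.1) p.2‖ₑ ^ α :=
      (measurable_linComb J θ (hf.measurable 0) (hf.continuous 0)).enorm.pow_const α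
    rw [hlaw 0 (fun v => ‖v‖ₑ ^ α) (by fun_prop), ← hwν,
      lintegral_withDensity_eq_lintegral_mul _ (by fun_prop) hjm.lintegral_prod_left']
    refine lintegral_congr fun x => ?_
    have hxm : Measurable fun ω => ‖linComb J θ (f 0 ω) x‖ₑ ^ α :=
      ((measurable_linComb_apply J θ x).comp (hf.measurable 0)).enorm.pow_const α
    rw [Pi.mul_apply, ← lintegral_const_mul _ hxm]
    refine lintegral_congr fun ω => ?_
    rw [enorm_mul, ENNReal.mul_rpow_of_nonneg _ _ hα.le]
  refine ⟨{
    arrival := hΓ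
    measurable_G := hGm
    measurable_V := hVm
    law_G := hG
    identDistrib_V := fun n => ⟨(hVm n).aemeasurable, (hVm 0).aemeasurable, ?_⟩
    moment := ?_
    indep_marks := fun n => ?_
    indep_pair := fun n => ?_
    iIndep_G := ?_
    indep_G := ?_ }, hmom⟩
  · refine Measure.ext_of_lintegral _ fun F hF => ?_
    rw [lintegral_map hF (hVm n), lintegral_map hF (hVm 0), hlaw n F hF, hlaw 0 F hF]
  · rw [hmom]
    exact hf.lintegral_lintegral_linComb_ne_top J θ hα 0
  -- in each independence claim, `T` collects the sources of one side and `Tᶜ` those of the other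
  · set T : Set (Unit ⊕ ℕ ⊕ ℕ ⊕ ℕ) :=
      {.inr (.inl n), .inr (.inr (.inl n)), .inr (.inr (.inr n))} with hT
    refine indepFun_of_iIndep_of_measurable_iSup hle hind (S := Tᶜ) (T := T) disjoint_compl_left
      ?_ ?_
    · refine (measurable_arrivals_of_mem (by simp [hT])).prodMk
        (@measurable_pi_lambda _ _ _ (_) _ _ fun k => ?_)
      have hk := k.2.ne
      exact (measurable_G_of_mem (by simp [hT, hk])).prodMk
        (hVS k _ (by simp [hT, hk]) (by simp [hT, hk]))
    · exact (measurable_G_of_mem (by simp [hT])).prodMk (hVS n _ (by simp [hT]) (by simp [hT]))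
  · refine indepFun_of_iIndep_of_measurable_iSup hle hind (S := {.inr (.inl n)}ᶜ)
      (T := {.inr (.inl n)}) disjoint_compl_left ?_ ?_
    · exact hVS n _ (by simp) (by simp)
    · exact measurable_G_of_mem rfl
  · exact hind.precomp (g := fun n : ℕ => .inr (.inl n)) fun a b hab => by simpa using hab
  · set T : Set (Unit ⊕ ℕ ⊕ ℕ ⊕ ℕ) := Set.range fun n : ℕ => .inr (.inl n) with hT
    refine indepFun_of_iIndep_of_measurable_iSup hle hind (S := Tᶜ) (T := T) disjoint_compl_left
      ?_ ?_
    · exact (measurable_arrivals_of_mem (by simp [hT])).prodMk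
        (@measurable_pi_lambda _ _ _ (_) _ _ fun n => hVS n _ (by simp [hT]) (by simp [hT]))
    · exact @measurable_pi_lambda _ _ _ (_) _ _ fun n => measurable_G_of_mem (by simp [hT])

theorem ae_exists_tendsto_partialSum (hα : 0 < α) (hα2 : α < 2)
    (hdata : ∀ (J : Finset ℝ≥0) (θ : ℝ≥0 → ℝ),
      IsStableSeriesData P α Γ G (fun n ω => w (X n ω) * linComb J θ (f n ω) (X n ω)))
    (t : ℝ≥0) :
    ∀ᵐ ω ∂P, ∃ y, Tendsto (fun N => partialSum α Γ G w X f N ω t) atTop (𝓝 y) := by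
  filter_upwards [(hdata {t} fun _ => 1).ae_exists_tendsto hα hα2] with ω hω
  simpa [← sum_mul_partialSum] using hω

/-- The characteristic functions of the finite-dimensional distributions of the series. The
right-hand side depends neither on the weight nor on the law of the positions. -/
theorem integral_exp_sum_mul_I (hα : 0 < α) (hα2 : α < 2)
    (hdata : ∀ (J : Finset ℝ≥0) (θ : ℝ≥0 → ℝ),
      IsStableSeriesData P α Γ G (fun n ω => w (X n ω) * linComb J θ (f n ω) (X n ω)) ∧
      ∫⁻ ω, ‖w (X 0 ω) * linComb J θ (f 0 ω) (X 0 ω)‖ₑ ^ α ∂P =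
        ∫⁻ x : ℝ, ∫⁻ ω, ‖linComb J θ (f 0 ω) x‖ₑ ^ α ∂P)
    {Y : Ω → ℝ≥0 → ℝ}
    (hY : ∀ t, ∀ᵐ ω ∂P, Tendsto (fun N => partialSum α Γ G w X f N ω t) atTop (𝓝 (Y ω t)))
    (J : Finset ℝ≥0) (θ : ℝ≥0 → ℝ) :
    ∫ ω, Complex.exp ((∑ t ∈ J, θ t * Y ω t : ℝ) * Complex.I) ∂P =
      (Real.exp (-(stableConst α *
        (∫⁻ x : ℝ, ∫⁻ ω, ‖linComb J θ (f 0 ω) x‖ₑ ^ α ∂P).toReal)) : ℂ) := by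
  rw [← (hdata J θ).2]
  refine (hdata J θ).1.integral_exp_mul_I hα hα2 ?_
  have hall : ∀ᵐ ω ∂P, ∀ t : J,
      Tendsto (fun N => partialSum α Γ G w X f N ω t) atTop (𝓝 (Y ω t)) :=
    ae_all_iff.2 fun t => hY t
  filter_upwards [hall] with ω hω
  simp_rw [← sum_mul_partialSum]
  exact tendsto_finsetSum _ fun t ht => (hω ⟨t, ht⟩).const_mul _

/-- Measurability holds also where the series diverges, since `limUnder` is then constant. -/
theorem measurable_series (hΓ : ∀ n, Measurable (Γ n)) (hG : ∀ n, Measurable (G n))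
    (hX : ∀ n, Measurable (X n)) (hf : ∀ n, Measurable (f n)) (hfc : ∀ n ω, Continuous (f n ω))
    (hw : Measurable w) : Measurable fun ω t => series α Γ G w X f ω t := by
  refine measurable_pi_lambda _ fun t => StronglyMeasurable.measurable ?_
  refine StronglyMeasurable.limUnder fun N => Measurable.stronglyMeasurable ?_
  refine Finset.measurable_fun_sum _ fun n _ => ?_
  have h := measurable_mul_linComb {t} (fun _ => 1) (hf n) (hfc n) (hX n) hw
  simp only [linComb, Finset.sum_singleton, one_mul] at h
  simp_rw [mul_assoc]
  have hΓn := hΓ n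
  have hGn := hG n
  fun_prop

/-- Two processes with the same characteristic functions of linear combinations have the same
law. -/
theorem identDistrib_of_integral_exp_eq {Y Z : Ω → ℝ≥0 → ℝ} (hY : Measurable Y)
    (hZ : Measurable Z)
    (h : ∀ (J : Finset ℝ≥0) (θ : ℝ≥0 → ℝ),
      ∫ ω, Complex.exp ((∑ t ∈ J, θ t * Y ω t : ℝ) * Complex.I) ∂P =
      ∫ ω, Complex.exp ((∑ t ∈ J, θ t * Z ω t : ℝ) * Complex.I) ∂P) :
    IdentDistrib Y Z P P := by
  refine (identDistrib_iff_forall_finset_identDistrib (X := fun t ω => Y ω t)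
    (Y := fun t ω => Z ω t) hY.aemeasurable hZ.aemeasurable).2 fun I => ?_
  have hYI : Measurable fun ω => I.restrict (fun t => Y ω t) :=
    (Finset.measurable_restrict I).comp hY
  have hZI : Measurable fun ω => I.restrict (fun t => Z ω t) :=
    (Finset.measurable_restrict I).comp hZ
  refine ⟨hYI.aemeasurable, hZI.aemeasurable, ?_⟩
  have := Measure.isFiniteMeasure_map P fun ω => I.restrict (fun t => Y ω t)
  have := Measure.isFiniteMeasure_map P fun ω => I.restrict (fun t => Z ω t)
  refine Measure.ext_of_charFunDual (funext fun L => ?_)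
  classical
  set θ : ℝ≥0 → ℝ := fun t => if ht : t ∈ I then L (Pi.single ⟨t, ht⟩ 1) else 0 with hθ
  have hL : ∀ v : ℝ≥0 → ℝ, L (I.restrict v) = ∑ t ∈ I, θ t * v t := by
    intro v
    rw [← Finset.sum_attach]
    have h1 := LinearMap.pi_apply_eq_sum_univ (L : (I → ℝ) →ₗ[ℝ] ℝ) (I.restrict v)
    simp only [ContinuousLinearMap.coe_coe] at h1
    rw [h1]
    refine Finset.sum_congr rfl fun i _ => ?_
    have hi : θ i = L (Pi.single i 1) := by simp [hθ, i.2]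
    rw [hi, smul_eq_mul, mul_comm]
    congr 2
    ext j
    simp [Pi.single_apply, eq_comm]
  rw [charFunDual_apply, charFunDual_apply, integral_map hYI.aemeasurable (by fun_prop),
    integral_map hZI.aemeasurable (by fun_prop)]
  simp_rw [hL]
  exact h I θ

end Series

/-! ### The two weights -/

section Weights

variable {α : ℝ} {φ : ℝ → ℝ}

theorem measurable_densityWeight (hφ : Measurable φ) : Measurable (densityWeight α φ) := by
  unfold densityWeight
  fun_prop

theorem measurable_gaussWeight : Measurable (gaussWeight α) := by
  unfold gaussWeight
  fun_prop

theorem withDensity_densityWeight (hα : 0 < α) (hφ : Measurable φ) (hpos : ∀ᵐ x, 0 < φ x) :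
    (volume.withDensity fun x => ENNReal.ofReal (φ x)).withDensity
      (fun x => ‖densityWeight α φ x‖ₑ ^ α) = volume := by
  have hm := measurable_densityWeight (α := α) hφ
  rw [← withDensity_mul _ (by fun_prop) (by fun_prop)]
  conv_rhs => rw [← withDensity_one (μ := (volume : Measure ℝ))]
  refine withDensity_congr_ae ?_
  filter_upwards [hpos] with x hx
  have h0 : 0 ≤ densityWeight α φ x := Real.rpow_nonneg hx.le _
  rw [Pi.mul_apply, Real.enorm_eq_ofReal h0, ENNReal.ofReal_rpow_of_nonneg h0 hα.le,
    ← ENNReal.ofReal_mul hx.le, densityWeight, ← Real.rpow_mul hx.le,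
    div_mul_cancel₀ _ hα.ne', Real.rpow_neg_one, mul_inv_cancel₀ hx.ne', ENNReal.ofReal_one,
    Pi.one_apply]

theorem withDensity_gaussWeight (hα : 0 < α) :
    (gaussianReal 0 1).withDensity
      (fun x => ‖(2 * Real.pi) ^ (1 / (2 * α)) * gaussWeight α x‖ₑ ^ α) = volume := by
  have hm := measurable_gaussWeight (α := α)
  rw [gaussianReal_of_var_ne_zero _ one_ne_zero,
    ← withDensity_mul _ (measurable_gaussianPDF 0 1) (by fun_prop)]
  conv_rhs => rw [← withDensity_one (μ := (volume : Measure ℝ))]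
  refine withDensity_congr_ae (ae_of_all _ fun x => ?_)
  have hpi : 0 < 2 * Real.pi := by positivity
  have h0 : 0 ≤ (2 * Real.pi) ^ (1 / (2 * α)) * gaussWeight α x :=
    mul_nonneg (Real.rpow_nonneg hpi.le _) (Real.exp_nonneg _)
  rw [Pi.mul_apply, Real.enorm_eq_ofReal h0, ENNReal.ofReal_rpow_of_nonneg h0 hα.le,
    gaussianPDF, ← ENNReal.ofReal_mul (gaussianPDFReal_nonneg _ _ _), Pi.one_apply,
    ← ENNReal.ofReal_one]
  congr 1
  rw [gaussWeight, Real.mul_rpow (Real.rpow_nonneg hpi.le _) (Real.exp_nonneg _),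
    ← Real.rpow_mul hpi.le, ← Real.exp_mul, gaussianPDFReal]
  have e1 : 1 / (2 * α) * α = 1 / 2 := by field_simp
  have e2 : x ^ 2 / (2 * α) * α = x ^ 2 / 2 := by field_simp
  rw [e1, e2, ← Real.sqrt_eq_rpow]
  have e3 : Real.exp (-((x - 0) ^ 2 / (2 * ((1 : ℝ≥0) : ℝ)))) * Real.exp (x ^ 2 / 2) = 1 := by
    rw [← Real.exp_add]
    simp
  have e4 : Real.sqrt (2 * Real.pi * ((1 : ℝ≥0) : ℝ)) = Real.sqrt (2 * Real.pi) := by simp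
  have e5 : Real.sqrt (2 * Real.pi) ≠ 0 := (Real.sqrt_pos.2 hpi).ne'
  rw [e4]
  field_simp
  exact e3

end Weights

end ShotNoise

theorem mainTheorem9 {Ω : Type*} [MeasurableSpace Ω] (P : Measure Ω) [IsProbabilityMeasure P]
    (α H ρ : ℝ) (hα : 0 < α) (hα2 : α < 2) (hH : 0 < H) (hH1 : H < 1) (hρ : 0 ≤ ρ)
    (φ : ℝ → ℝ) (hφ_meas : Measurable φ) (hφ_pos : ∀ᵐ x, 0 < φ x)
    (hφ_int : ∃ q : ℝ, 0 < q ∧ ∀ a : ℝ, 0 < a →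
      ∫⁻ x : ℝ, ENNReal.ofReal (φ x ^ (-q / α + 1) * Real.exp (-a * x ^ 2)) < ∞)
    (Γ G X' X : ℕ → Ω → ℝ) (f : ℕ → Ω → ℝ × ℝ≥0 → ℝ) (B : ℕ → ℝ≥0 → Ω → ℝ)
    (hΓ : ShotNoise.IsPoissonArrivalTimes P Γ)
    (hG_meas : ∀ n, Measurable (G n)) (hG : ∀ n, HasLaw (G n) (gaussianReal 0 1) P)
    (hX'_meas : ∀ n, Measurable (X' n)) (hX' : ∀ n, HasLaw (X' n) (gaussianReal 0 1) P)
    (hX_meas : ∀ n, Measurable (X n))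
    (hX : ∀ n, HasLaw (X n) (volume.withDensity (fun x => ENNReal.ofReal (φ x))) P)
    (hf : ShotNoise.IsKernelSequence P H ρ f B)
    (hindep' : ShotNoise.MutuallyIndependent P Γ G X' f B)
    (hindep : ShotNoise.MutuallyIndependent P Γ G X f B) :
    -- both series converge almost surely, for every `t`
    (∀ t : ℝ≥0, ∀ᵐ ω ∂P, ∃ y : ℝ, Tendsto
      (fun N => ShotNoise.partialSum α Γ G (ShotNoise.gaussWeight α) X' f N ω t) atTop (𝓝 y)) ∧
    (∀ t : ℝ≥0, ∀ᵐ ω ∂P, ∃ y : ℝ, Tendsto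
      (fun N => ShotNoise.partialSum α Γ G (ShotNoise.densityWeight α φ) X f N ω t)
      atTop (𝓝 y)) ∧
    -- `Y_φ` and `(2π)^{1/(2α)} Y` have the same law as processes on `[0, ∞)`
    IdentDistrib
      (fun ω t => ShotNoise.series α Γ G (ShotNoise.densityWeight α φ) X f ω t)
      (fun ω t => (2 * Real.pi) ^ (1 / (2 * α)) *
        ShotNoise.series α Γ G (ShotNoise.gaussWeight α) X' f ω t) P P := by
  -- the constant is absorbed into the weight, so that both weights turn the law of the positions
  -- into Lebesgue measure
  set w : ℝ → ℝ := fun x => (2 * Real.pi) ^ (1 / (2 * α)) * ShotNoise.gaussWeight α x with hw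
  have hwm : Measurable w := ShotNoise.measurable_gaussWeight.const_mul _
  have hφm : Measurable (ShotNoise.densityWeight α φ) := ShotNoise.measurable_densityWeight hφ_meas
  have hdata := ShotNoise.isStableSeriesData_linComb hα hΓ hG_meas hG hX_meas hX hf hindep hφm
    (ShotNoise.withDensity_densityWeight hα hφ_meas hφ_pos)
  have hdata' := ShotNoise.isStableSeriesData_linComb hα hΓ hG_meas hG hX'_meas hX' hf hindep' hwm
    (ShotNoise.withDensity_gaussWeight hα)
  have hconv := ShotNoise.ae_exists_tendsto_partialSum hα hα2 fun J θ => (hdata J θ).1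
  have hconvw := ShotNoise.ae_exists_tendsto_partialSum hα hα2 fun J θ => (hdata' J θ).1
  have hκ : (2 * Real.pi) ^ (1 / (2 * α)) ≠ 0 :=
    (Real.rpow_pos_of_pos (by positivity) _).ne'
  have hsum : ∀ N ω t, ShotNoise.partialSum α Γ G w X' f N ω t =
      (2 * Real.pi) ^ (1 / (2 * α)) *
        ShotNoise.partialSum α Γ G (ShotNoise.gaussWeight α) X' f N ω t := fun N ω t => by
    simp only [ShotNoise.partialSum, Finset.mul_sum, hw]
    exact Finset.sum_congr rfl fun n _ => by ring
  have hconv' : ∀ t : ℝ≥0, ∀ᵐ ω ∂P, ∃ y : ℝ, Tendsto (fun N =>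
      ShotNoise.partialSum α Γ G (ShotNoise.gaussWeight α) X' f N ω t) atTop (𝓝 y) := fun t => by
    filter_upwards [hconvw t] with ω ⟨y, hy⟩
    simp_rw [hsum] at hy
    have := hy.const_mul ((2 * Real.pi) ^ (1 / (2 * α)))⁻¹
    simp_rw [inv_mul_cancel_left₀ hκ] at this
    exact ⟨_, this⟩
  refine ⟨hconv', hconv, ?_⟩
  refine ShotNoise.identDistrib_of_integral_exp_eq
    (ShotNoise.measurable_series hΓ.measurable hG_meas hX_meas hf.measurable hf.continuous hφm)
    (measurable_pi_lambda _ fun t => Measurable.const_mul ((measurable_pi_apply t).comp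
      (ShotNoise.measurable_series hΓ.measurable hG_meas hX'_meas hf.measurable hf.continuous
        ShotNoise.measurable_gaussWeight)) _) fun J θ => ?_
  rw [ShotNoise.integral_exp_sum_mul_I hα hα2 hdata (fun t => ?_) J θ,
    ShotNoise.integral_exp_sum_mul_I hα hα2 hdata' (fun t => ?_) J θ]
  · filter_upwards [hconv' t] with ω hω
    simp_rw [hsum]
    exact (tendsto_nhds_limUnder hω).const_mul _
  · filter_upwards [hconv t] with ω hω
    exact tendsto_nhds_limUnder hω
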